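/- Let $\mathbf{Vect}$ be the category of finite-dimensional real vector spaces and linear maps. A structure category is a (not necessarily full) subcategory $\mathcal V\subset\mathbf{Vect}$; its morphism sets carry the subspace topology. Its closure $\bar{\mathcal V}$ has the same objects, and $\hom_{\bar{\mathcal V}}(V_1,V_2)$ is the closure of $\hom_{\mathcal V}(V_1,V_2)$ in $\hom_{\mathbf{Vect}}(V_1,V_2)$. Let $\mathcal V,\mathcal V',\mathcal W$ be structure categories. A bifunctor $\psi:\mathcal V\times\mathcal V'\to\mathcal W$ is continuous if it is continuous on morphism spaces; it is regular continuous if moreover it is the restriction of a continuous bifunctor $\bar\psi:\bar{\mathcal V}\times\bar{\mathcal V}'\to\bar{\mathcal W}$. A $\mathcal V$-family over $\bar X$ is a map $p:X\to\bar X$ together with, for each $b\in\bar X$, an object $X_b$ of $\mathcal V$ and a homeomorphism (chart) $p^{-1}(b)\approx X_b$. A $\mathcal V$-map of families is a continuous map of total spaces covering a continuous map of base spaces and given in the charts, on each fiber, by a morphism of $\mathcal V$. A $\mathcal V$-vector bundle is a family which is locally $\mathcal V$-isomorphic to a product family. A stratified space is a space $\bar X=\varinjlim\bar X_n$ with a filtration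 $\bar X_0\subset\bar X_1\subset\cdots$ such that $\bar X_0$ is a CW-space and, for $i\ge1$, $\bar X_i=\bar M_i\cup_{\bar h_i}\bar X_{i-1}$ is obtained by attaching a CW-pair $(\bar M_i,\bar A_i)$ along a map $\bar h_i:\bar A_i\to\bar X_{i-1}$; the attached pairs and maps are part of the structure. A $\mathcal V$-stratified bundle over $\bar X$ is a $\mathcal V$-family $X=\varinjlim X_i$, $X_i=X|\bar X_i$, such that $X_0$ is a $\mathcal V$-vector bundle and, for $i\ge 1$, $X_i$ is the push-out $M_i\cup_{h_i}X_{i-1}$ of $\mathcal V$-families, where $M_i$ is a given $\mathcal V$-vector bundle over $\bar M_i$, $A_i=M_i|\bar A_i$ and $h_i:A_i\to X_{i-1}$ is a $\mathcal V$-map over $\bar h_i$. The category $\mathcal V\text{-}\mathbf{Stra}$ has as objects the $\mathcal V$-stratified bundles and as morphisms the pairs $(f,(g_i)_{i\ge1})$ consisting of a filtration-preserving $\mathcal V$-map $f:X\to X'$ with $f(X_i\smallsetminus X_{i-1})\subset X'_i\smallsetminus X'_{i-1}$ for all $i$, and $\mathcal V$-maps $g_i:M_i\to M_i'$ with $g_i(A_i)\subset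 A'_i$, compatible with the maps $M_i\to X_i$ and $M_i'\to X_i'$. Objects of $\mathcal V\text{-}\mathbf{Stra}\sqcap\mathcal V'\text{-}\mathbf{Stra}$ are pairs $(X,X')$ of a $\mathcal V$- and a $\mathcal V'$-stratified bundle over the same stratified space $\bar X$; morphisms are pairs of morphisms which induce the same map of stratified base spaces (including the maps $\bar M_i\to\bar M'_i$). **Theorem.** Every regular continuous bifunctor $\psi:\mathcal V\times\mathcal V'\to\mathcal W$ induces a functor $$\psi:\ \mathcal V\text{-}\mathbf{Stra}\sqcap\mathcal V'\text{-}\mathbf{Stra}\longrightarrow\mathcal W\text{-}\mathbf{Stra}$$ which sends $(X,X')$ over $\bar X$ to a $\mathcal W$-stratified bundle $\psi(X,X')$ over the same stratified space $\bar X$ with fibers $\psi(X_b,X'_b)$, $b\in\bar X$. Here $\psi(X,X')$ is obtained from $\psi(X_0,X_0')$ by successively attaching the $\mathcal W$-bundles $\psi(M_i,M_i')$ along the maps given fiberwise by $\psi(h_i,h'_i)$, where $\psi$ of two vector bundles over a common base has as local trivializations those obtained by applying $\psi$ fiberwise to trivializations of the two bundles. A morphism $(f,f')$ is sent to the morphism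 over the same map of base spaces which on fibers is $\psi(f_b,f'_b)$, and likewise $\psi(g_{i,m},g'_{i,m})$ on the fibers of the attached bundles. Moreover, whenever $\mathcal W$ contains the direct sums (respectively tensor products) of the objects and of the morphisms of $\mathcal V$ and $\mathcal V'$, the bifunctor $\oplus$ (respectively $\otimes$) $:\mathcal V\times\mathcal V'\to\mathcal W$ is regular continuous, so that the Whitney sum and the tensor product of stratified vector bundles are defined. -/

import Mathlib

open CategoryTheory Topology

universe u

namespace StratBdl

/-! ### Structure categories: subcategories of finite-dimensional real vector spaces -/

/-- The canonical topology of a finite-dimensional real vector space. -/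
instance instTopFG (X : FGModuleCat.{u} ℝ) : TopologicalSpace X := moduleTopology ℝ X

instance instIsModTopFG (X : FGModuleCat.{u} ℝ) : IsModuleTopology ℝ X := ⟨rfl⟩

/-- The canonical topology of the finite-dimensional real vector space of linear maps `X → Y`. -/
abbrev linTop (X Y : FGModuleCat.{u} ℝ) : TopologicalSpace (X →ₗ[ℝ] Y) :=
  moduleTopology ℝ (X →ₗ[ℝ] Y)

/-- A structure category: a (not necessarily full or wide) subcategory of the category of
finite-dimensional real vector spaces and linear maps. The sets `hom X Y` are only relevant
when `X` and `Y` are objects of the subcategory. -/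
structure StructureCategory where
  obj : Set (FGModuleCat.{u} ℝ)
  hom : ∀ X Y : FGModuleCat.{u} ℝ, Set (X →ₗ[ℝ] Y)
  id_mem : ∀ X ∈ obj, LinearMap.id ∈ hom X X
  comp_mem : ∀ X ∈ obj, ∀ Y ∈ obj, ∀ Z ∈ obj, ∀ f ∈ hom X Y, ∀ g ∈ hom Y Z, g ∘ₗ f ∈ hom X Z

/-- The objects of a structure category. -/
structure StructureCategory.Ob (V : StructureCategory.{u}) where
  carrier : FGModuleCat.{u} ℝ
  mem : carrier ∈ V.obj

instance (V : StructureCategory.{u}) : CoeSort V.Ob (Type u) := ⟨fun X => X.carrier⟩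

instance (V : StructureCategory.{u}) : Category V.Ob where
  Hom X Y := { f : X.carrier →ₗ[ℝ] Y.carrier // f ∈ V.hom X.carrier Y.carrier }
  id X := ⟨LinearMap.id, V.id_mem _ X.mem⟩
  comp {X Y Z} f g := ⟨g.1 ∘ₗ f.1, V.comp_mem _ X.mem _ Y.mem _ Z.mem _ f.2 _ g.2⟩

/-- The linear map underlying a morphism of a structure category. -/
def toLin {V : StructureCategory.{u}} {X Y : V.Ob} (f : X ⟶ Y) : X →ₗ[ℝ] Y := f.1

/-- The subspace topology on the morphism sets of a structure category. -/
instance instTopHom {V : StructureCategory.{u}} (X Y : V.Ob) : TopologicalSpace (X ⟶ Y) :=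
  @TopologicalSpace.induced _ _ toLin (linTop X.carrier Y.carrier)

theorem continuous_comp_lin (X Y Z : FGModuleCat.{u} ℝ) :
    letI := linTop X Y
    letI := linTop Y Z
    letI := linTop X Z
    Continuous fun q : (X →ₗ[ℝ] Y) × (Y →ₗ[ℝ] Z) => q.2 ∘ₗ q.1 := by
  let _ := linTop X Y
  let _ := linTop Y Z
  let _ := linTop X Z
  have : IsModuleTopology ℝ (X →ₗ[ℝ] Y) := ⟨rfl⟩
  have : IsModuleTopology ℝ (Y →ₗ[ℝ] Z) := ⟨rfl⟩
  have : IsModuleTopology ℝ (X →ₗ[ℝ] Z) := ⟨rfl⟩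
  exact IsModuleTopology.continuous_bilinear_of_finite_left (LinearMap.llcomp ℝ X Y Z).flip

/-- The closure of a structure category: same objects, the morphism sets are the closures of the
given ones in the spaces of all linear maps. -/
def StructureCategory.closure (V : StructureCategory.{u}) : StructureCategory.{u} where
  obj := V.obj
  hom X Y := @_root_.closure _ (linTop X Y) (V.hom X Y)
  id_mem X hX := @subset_closure _ (linTop X X) _ _ (V.id_mem X hX)
  comp_mem X hX Y hY Z hZ f hf g hg := by
    let _ := linTop X Y
    let _ := linTop Y Z
    let _ := linTop X Z
    have hfg : (f, g) ∈ _root_.closure (V.hom X Y ×ˢ V.hom Y Z) := by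
      rw [closure_prod_eq]; exact ⟨hf, hg⟩
    exact map_mem_closure (f := fun q : (X →ₗ[ℝ] Y) × (Y →ₗ[ℝ] Z) => q.2 ∘ₗ q.1)
      (continuous_comp_lin X Y Z) hfg
      fun q hq => V.comp_mem X hX Y hY Z hZ q.1 hq.1 q.2 hq.2

/-- The inclusion of a structure category into its closure. -/
def StructureCategory.incl (V : StructureCategory.{u}) : V.Ob ⥤ V.closure.Ob where
  obj X := ⟨X.carrier, X.mem⟩
  map {X Y} f := ⟨f.1, @subset_closure _ (linTop X.carrier Y.carrier) _ _ f.2⟩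

/-- A bifunctor between structure categories is continuous if it is continuous on morphism
spaces. -/
def IsContinuousBifunctor {V V' W : StructureCategory.{u}} (ψ : V.Ob × V'.Ob ⥤ W.Ob) : Prop :=
  ∀ (X Y : V.Ob) (X' Y' : V'.Ob),
    Continuous fun q : (X ⟶ Y) × (X' ⟶ Y') => ψ.map (Prod.mkHom q.1 q.2)

/-- A regular continuous bifunctor: a continuous bifunctor which is the restriction of a continuous
bifunctor between the closures of the structure categories. -/
def IsRegularContinuous {V V' W : StructureCategory.{u}} (ψ : V.Ob × V'.Ob ⥤ W.Ob) : Prop :=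
  IsContinuousBifunctor ψ ∧
    ∃ Ψ : V.closure.Ob × V'.closure.Ob ⥤ W.closure.Ob,
      IsContinuousBifunctor Ψ ∧ V.incl.prod V'.incl ⋙ Ψ = ψ ⋙ W.incl

/-- The direct sum as a bifunctor `V × V' → W`, for structure categories such that `W` contains the
direct sums of objects and of morphisms of `V` and `V'`. -/
def directSum (V V' W : StructureCategory.{u})
    (hobj : ∀ (X : V.Ob) (X' : V'.Ob), FGModuleCat.of ℝ (X × X') ∈ W.obj)
    (hhom : ∀ {X Y : V.Ob} {X' Y' : V'.Ob} (f : X ⟶ Y) (f' : X' ⟶ Y'),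
      (toLin f).prodMap (toLin f') ∈
        W.hom (FGModuleCat.of ℝ (X × X')) (FGModuleCat.of ℝ (Y × Y'))) :
    V.Ob × V'.Ob ⥤ W.Ob where
  obj X := ⟨FGModuleCat.of ℝ (X.1 × X.2), hobj X.1 X.2⟩
  map f := ⟨(toLin f.1).prodMap (toLin f.2), hhom f.1 f.2⟩
  map_id _ := Subtype.ext LinearMap.prodMap_id
  map_comp _ _ := Subtype.ext (LinearMap.prodMap_comp _ _ _ _).symm

/-- The tensor product as a bifunctor `V × V' → W`, for structure categories such that `W` contains
the tensor products of objects and of morphisms of `V` and `V'`. -/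
noncomputable def tensorProduct (V V' W : StructureCategory.{u})
    (hobj : ∀ (X : V.Ob) (X' : V'.Ob), FGModuleCat.of ℝ (TensorProduct ℝ X X') ∈ W.obj)
    (hhom : ∀ {X Y : V.Ob} {X' Y' : V'.Ob} (f : X ⟶ Y) (f' : X' ⟶ Y'),
      TensorProduct.map (toLin f) (toLin f') ∈
        W.hom (FGModuleCat.of ℝ (TensorProduct ℝ X X'))
          (FGModuleCat.of ℝ (TensorProduct ℝ Y Y'))) :
    V.Ob × V'.Ob ⥤ W.Ob where
  obj X := ⟨FGModuleCat.of ℝ (TensorProduct ℝ X.1 X.2), hobj X.1 X.2⟩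
  map f := ⟨TensorProduct.map (toLin f.1) (toLin f.2), hhom f.1 f.2⟩
  map_id _ := Subtype.ext TensorProduct.map_id
  map_comp _ _ := Subtype.ext (TensorProduct.map_comp _ _ _ _)

/-! ### Families of vector spaces and vector bundles -/

/-- A `V`-family over `B` whose fiber over `b` is the object `fib b` of `V`: a total space with a
projection to `B` and, for every `b`, a chart from the actual fiber `p⁻¹(b)` to `fib b`. -/
structure VFamily (V : StructureCategory.{u}) (B : Type u) [TopologicalSpace B]
    (fib : B → V.Ob) where
  Total : Type u
  [top : TopologicalSpace Total]
  proj : Total → B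
  continuous_proj : Continuous proj
  chart : ∀ b, (proj ⁻¹' {b} : Set Total) ≃ₜ (fib b : Type u)

attribute [instance] VFamily.top

section Families

variable {V : StructureCategory.{u}} {B B' B'' : Type u}
  [TopologicalSpace B] [TopologicalSpace B'] [TopologicalSpace B'']
  {fib : B → V.Ob} {fib' : B' → V.Ob} {fib'' : B'' → V.Ob}

/-- The inverse chart at `b`, as a map from `fib b` to the total space. -/
def VFamily.emb (X : VFamily V B fib) (b : B) (v : fib b) : X.Total := ((X.chart b).symm v).1

/-- A `V`-map over `φ`: a continuous map of total spaces which, read in the charts, is given on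
each fiber by a morphism `fib b ⟶ fib' (φ b)` of `V` (in particular it covers `φ`). The morphisms
`fiberMap b` are determined by `toFun`. -/
structure VMap (φ : C(B, B')) (X : VFamily V B fib) (Y : VFamily V B' fib') where
  toFun : C(X.Total, Y.Total)
  fiberMap : ∀ b, fib b ⟶ fib' (φ b)
  map_emb : ∀ b (v : fib b), toFun (X.emb b v) = Y.emb (φ b) (toLin (fiberMap b) v)

/-- The identity `V`-map. -/
def VMap.id (X : VFamily V B fib) : VMap (ContinuousMap.id B) X X where
  toFun := ContinuousMap.id _
  fiberMap b := 𝟙 (fib b)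
  map_emb _ _ := rfl

/-- Composition of `V`-maps. -/
def VMap.comp {φ : C(B, B')} {φ' : C(B', B'')} {X : VFamily V B fib} {Y : VFamily V B' fib'}
    {Z : VFamily V B'' fib''} (g : VMap φ' Y Z) (f : VMap φ X Y) : VMap (φ'.comp φ) X Z where
  toFun := g.toFun.comp f.toFun
  fiberMap b := f.fiberMap b ≫ g.fiberMap (φ b)
  map_emb b v := (congrArg g.toFun (f.map_emb b v)).trans (g.map_emb _ _)

/-- Isomorphisms `e b : V₀ ≅ fib b` in `V`, for `b ∈ U`, form a trivialization of `X` over `U` if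
the bijection `U × V₀ → p⁻¹(U)` that they define is a homeomorphism, i.e. if they define a
`V`-isomorphism between the product family `U × V₀` and the restriction `X|U`. -/
def VFamily.IsTrivialization (X : VFamily V B fib) (U : Set B) (V₀ : V.Ob)
    (e : ∀ b : U, V₀ ≅ fib b) : Prop :=
  IsEmbedding fun q : U × V₀ => X.emb q.1 (toLin (e q.1).hom q.2)

/-- The restriction of `X` to `C` is a `V`-vector bundle, i.e. locally trivial. -/
def VFamily.IsBundleOn (X : VFamily V B fib) (C : Set B) : Prop :=
  ∀ b ∈ C, ∃ U ∈ 𝓝[C] b, U ⊆ C ∧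
    ∃ (V₀ : V.Ob) (e : ∀ b : U, V₀ ≅ fib b), X.IsTrivialization U V₀ e

end Families

/-! ### Stratified spaces -/

/-- `M` is a CW-complex (for some cell structure). -/
def IsCWSpace (M : Type u) [TopologicalSpace M] : Prop :=
  T2Space M ∧ Nonempty (CWComplex (Set.univ : Set M))

/-- `(M, A)` is a CW-pair: `M` is a CW-complex and `A` a subcomplex (for some cell structure). -/
def IsCWPair (M : Type u) [TopologicalSpace M] (A : Set M) : Prop :=
  T2Space M ∧ ∃ (_ : CWComplex (Set.univ : Set M))
    (E : CWComplex.Subcomplex (Set.univ : Set M)), (E : Set M) = A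

/-- For subspaces `Z₀ ⊆ Z₁` of `Z`, the space `Z₁` is obtained by attaching `M` to `Z₀` along the
map `A → Z₀` which is the restriction of the characteristic map `c : M → Z`. That is, the square
formed by `A → Z₀`, `A ⊆ M`, `c : M → Z₁`, `Z₀ ⊆ Z₁` is a push-out of topological spaces. -/
structure IsAttached {Z M : Type u} [TopologicalSpace Z] [TopologicalSpace M]
    (Z₀ Z₁ : Set Z) (A : Set M) (c : M → Z) : Prop where
  continuous : Continuous c
  subset : Z₀ ⊆ Z₁
  mapsTo : Set.MapsTo c A Z₀
  bijOn : Set.BijOn c Aᶜ (Z₁ \ Z₀)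
  isClosed_iff : ∀ S : Set Z, S ⊆ Z₁ →
    (IsClosed ((↑) ⁻¹' S : Set Z₁) ↔ IsClosed (c ⁻¹' S) ∧ IsClosed ((↑) ⁻¹' S : Set Z₀))

/-- A space is the colimit of a sequence of subspaces. -/
structure IsFiltrationColimit {Z : Type u} [TopologicalSpace Z] (F : ℕ → Set Z) : Prop where
  iUnion_eq : ⋃ n, F n = Set.univ
  isClosed_of : ∀ S : Set Z, (∀ n, IsClosed ((↑) ⁻¹' S : Set (F n))) → IsClosed S

/-- A stratified space: a filtered space such that `filt 0` is a CW-space and `filt (i + 1)` is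
obtained from `filt i` by attaching the CW-pair `(M i, A i)`. The attaching map is the restriction
of the characteristic map `char i` to `A i`. -/
structure StratSpace where
  carrier : Type u
  [top : TopologicalSpace carrier]
  filt : ℕ → Set carrier
  M : ℕ → Type u
  [topM : ∀ i, TopologicalSpace (M i)]
  A : ∀ i, Set (M i)
  char : ∀ i, C(M i, carrier)
  isCWSpace_zero : IsCWSpace (filt 0)
  isCWPair : ∀ i, IsCWPair (M i) (A i)
  isAttached : ∀ i, IsAttached (filt i) (filt (i + 1)) (A i) (char i)
  isColimit : IsFiltrationColimit filt

attribute [instance] StratSpace.top StratSpace.topM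

instance : CoeSort StratSpace.{u} (Type u) := ⟨StratSpace.carrier⟩

/-- A stratum-preserving map of stratified spaces: a filtration-preserving map together with maps
of the attached pairs which are compatible with the characteristic maps. -/
@[ext]
structure StratMap (S T : StratSpace.{u}) where
  toFun : C(S, T)
  att : ∀ i, C(S.M i, T.M i)
  mapsTo_filt : ∀ i, Set.MapsTo toFun (S.filt i) (T.filt i)
  mapsTo_strata : ∀ i, Set.MapsTo toFun (S.filt (i + 1) \ S.filt i) (T.filt (i + 1) \ T.filt i)
  mapsTo_A : ∀ i, Set.MapsTo (att i) (S.A i) (T.A i)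
  comm : ∀ i m, toFun (S.char i m) = T.char i (att i m)

/-- The identity map of a stratified space. -/
def StratMap.id (S : StratSpace.{u}) : StratMap S S where
  toFun := ContinuousMap.id S
  att i := ContinuousMap.id (S.M i)
  mapsTo_filt i := Set.mapsTo_id (S.filt i)
  mapsTo_strata i := Set.mapsTo_id (S.filt (i + 1) \ S.filt i)
  mapsTo_A i := Set.mapsTo_id (S.A i)
  comm _ _ := rfl

/-- Composition of stratum-preserving maps. -/
def StratMap.comp {S T R : StratSpace.{u}} (g : StratMap T R) (f : StratMap S T) :
    StratMap S R where
  toFun := g.toFun.comp f.toFun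
  att i := (g.att i).comp (f.att i)
  mapsTo_filt i := (g.mapsTo_filt i).comp (f.mapsTo_filt i)
  mapsTo_strata i := (g.mapsTo_strata i).comp (f.mapsTo_strata i)
  mapsTo_A i := (g.mapsTo_A i).comp (f.mapsTo_A i)
  comm i m := (congrArg g.toFun (f.comm i m)).trans (g.comm i _)

/-! ### Stratified vector bundles -/

/-- A choice of fibers in `V` for a stratified bundle over `S`: over the points of `S` and over the
points of the attached spaces. -/
structure Fibers (V : StructureCategory.{u}) (S : StratSpace.{u}) where
  base : S → V.Ob
  att : ∀ i, S.M i → V.Ob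

/-- A `V`-stratified bundle over `S` with given fibers: a `V`-family `fam` over `S` which is a
`V`-vector bundle over `filt 0`, together with `V`-vector bundles `att i` over the attached spaces
and characteristic `V`-maps `char i`, such that the part over `filt (i + 1)` is the push-out of
`V`-families of `att i ← (att i)|A → (part over filt i)`: it is the adjunction space, and its
fibers over the new points are those of `att i`, up to isomorphism in `V`. -/
structure StratBundle (V : StructureCategory.{u}) (S : StratSpace.{u}) (F : Fibers V S) where
  fam : VFamily V S F.base
  att : ∀ i, VFamily V (S.M i) (F.att i)
  char : ∀ i, VMap (S.char i) (att i) fam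
  isBundle_zero : fam.IsBundleOn (S.filt 0)
  isBundle_att : ∀ i, (att i).IsBundleOn Set.univ
  isAttached : ∀ i, IsAttached (fam.proj ⁻¹' S.filt i) (fam.proj ⁻¹' S.filt (i + 1))
    ((att i).proj ⁻¹' S.A i) (char i).toFun
  isIso_char : ∀ i, ∀ m ∉ S.A i, IsIso ((char i).fiberMap m)
  isColimit : IsFiltrationColimit fun n => fam.proj ⁻¹' S.filt n

/-- A `V`-stratified map over a stratum-preserving map `φ` of the base spaces. -/
structure StratBundleMap {V : StructureCategory.{u}} {S T : StratSpace.{u}} (φ : StratMap S T)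
    {F : Fibers V S} {G : Fibers V T} (X : StratBundle V S F) (Y : StratBundle V T G) where
  map : VMap φ.toFun X.fam Y.fam
  att : ∀ i, VMap (φ.att i) (X.att i) (Y.att i)
  comm : ∀ i x, map.toFun ((X.char i).toFun x) = (Y.char i).toFun ((att i).toFun x)

/-- The identity `V`-stratified map. -/
def StratBundleMap.id {V : StructureCategory.{u}} {S : StratSpace.{u}} {F : Fibers V S}
    (X : StratBundle V S F) : StratBundleMap (StratMap.id S) X X where
  map := VMap.id X.fam
  att i := VMap.id (X.att i)
  comm _ _ := rfl

/-- Composition of `V`-stratified maps. -/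
def StratBundleMap.comp {V : StructureCategory.{u}} {S T R : StratSpace.{u}} {φ : StratMap S T}
    {φ' : StratMap T R} {F : Fibers V S} {G : Fibers V T} {H : Fibers V R}
    {X : StratBundle V S F} {Y : StratBundle V T G} {Z : StratBundle V R H}
    (g : StratBundleMap φ' Y Z) (f : StratBundleMap φ X Y) :
    StratBundleMap (φ'.comp φ) X Z where
  map := g.map.comp f.map
  att i := (g.att i).comp (f.att i)
  comm i x := (congrArg g.map.toFun (f.comm i x)).trans (g.comm i _)

/-- The objects of the category `V`-Stra of `V`-stratified bundles. -/
structure VStra (V : StructureCategory.{u}) where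
  base : StratSpace.{u}
  fibers : Fibers V base
  bundle : StratBundle V base fibers

/-- The morphisms of `V`-Stra: stratum-preserving `V`-stratified maps. -/
structure VStra.Hom {V : StructureCategory.{u}} (X Y : VStra V) where
  base : StratMap X.base Y.base
  bundle : StratBundleMap base X.bundle Y.bundle

instance (V : StructureCategory.{u}) : Category (VStra V) where
  Hom := VStra.Hom
  id X := ⟨StratMap.id X.base, StratBundleMap.id X.bundle⟩
  comp f g := ⟨g.base.comp f.base, g.bundle.comp f.bundle⟩

/-- The objects of the category of pairs of a `V`-stratified bundle and a `V'`-stratified bundle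
over the same stratified space. -/
structure VStraPair (V V' : StructureCategory.{u}) where
  base : StratSpace.{u}
  fibers₁ : Fibers V base
  fibers₂ : Fibers V' base
  fst : StratBundle V base fibers₁
  snd : StratBundle V' base fibers₂

/-- A morphism of pairs: two stratum-preserving stratified maps over the same map of the base
spaces. -/
structure VStraPair.Hom {V V' : StructureCategory.{u}} (P Q : VStraPair V V') where
  base : StratMap P.base Q.base
  fst : StratBundleMap base P.fst Q.fst
  snd : StratBundleMap base P.snd Q.snd

instance (V V' : StructureCategory.{u}) : Category (VStraPair V V') where
  Hom := VStraPair.Hom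
  id P := ⟨StratMap.id P.base, StratBundleMap.id P.fst, StratBundleMap.id P.snd⟩
  comp f g := ⟨g.base.comp f.base, g.fst.comp f.fst, g.snd.comp f.snd⟩

/-! ### The bundle induced by a bifunctor -/

section Induced

variable {V V' W : StructureCategory.{u}} (ψ : V.Ob × V'.Ob ⥤ W.Ob)

/-- The fibers `ψ(X_b, X'_b)`. -/
def VStraPair.fibers (P : VStraPair V V') : Fibers W P.base where
  base b := ψ.obj (P.fibers₁.base b, P.fibers₂.base b)
  att i m := ψ.obj (P.fibers₁.att i m, P.fibers₂.att i m)

/-- Over `C ⊆ B` the family `E` with fibers `ψ(X_b, X'_b)` carries the topology induced by `ψ`: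
trivializations of `X` and `X'` over the same subset of `C` induce, by applying `ψ` fiberwise, a
trivialization of `E`. (When `X` and `X'` are bundles over `C`, this determines the topology of
`E` over neighborhoods in `C` of the points of `C`.) -/
def IsInducedOn {B : Type u} [TopologicalSpace B] {fib : B → V.Ob} {fib' : B → V'.Ob}
    (X : VFamily V B fib) (X' : VFamily V' B fib')
    (E : VFamily W B fun b => ψ.obj (fib b, fib' b)) (C : Set B) : Prop :=
  ∀ (U : Set B) (V₀ : V.Ob) (V₀' : V'.Ob) (e : ∀ b : U, V₀ ≅ fib b) (e' : ∀ b : U, V₀' ≅ fib' b),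
    U ⊆ C → X.IsTrivialization U V₀ e → X'.IsTrivialization U V₀' e' →
      E.IsTrivialization U (ψ.obj (V₀, V₀')) fun b => ψ.mapIso ((e b).prod (e' b))

/-- The stratified bundle `E` with fibers `ψ(X_b, X'_b)` is built from `ψ(X₀, X'₀)` by attaching
the bundles `ψ(Mᵢ, M'ᵢ)` along the maps obtained by applying `ψ` to the attaching maps. -/
structure IsInduced (P : VStraPair V V') (E : StratBundle W P.base (P.fibers ψ)) : Prop where
  zero : IsInducedOn ψ P.fst.fam P.snd.fam E.fam (P.base.filt 0)
  att : ∀ i, IsInducedOn ψ (P.fst.att i) (P.snd.att i) (E.att i) Set.univ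
  char : ∀ i m, (E.char i).fiberMap m =
    ψ.map (Prod.mkHom ((P.fst.char i).fiberMap m) ((P.snd.char i).fiberMap m))

/-- The stratified map `m` is given on fibers by `ψ(f_b, f'_b)`. -/
structure IsInducedMap {P Q : VStraPair V V'} (f : P ⟶ Q)
    {E : StratBundle W P.base (P.fibers ψ)} {E' : StratBundle W Q.base (Q.fibers ψ)}
    (m : StratBundleMap f.base E E') : Prop where
  map : ∀ b, m.map.fiberMap b =
    ψ.map (Prod.mkHom (f.fst.map.fiberMap b) (f.snd.map.fiberMap b))
  att : ∀ i x, (m.att i).fiberMap x =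
    ψ.map (Prod.mkHom ((f.fst.att i).fiberMap x) ((f.snd.att i).fiberMap x))

end Induced

end StratBdl

open StratBdl

namespace StratBdl

open Filter Set

/-! ### Sequential spaces -/

/-! For honest vector bundles only the continuity of ψ matters: it turns the transition functions of
two bundles into transition functions of a bundle with fibers ψ(X_b, X'_b). This settles ψ(X₀, X'₀),
the ψ(Mᵢ, M'ᵢ) and the maps between such bundles (`isOpenEmbedding_biTriv_of_isOpen`,
`isEmbedding_biTriv`, `continuous_biMap`).

The difficulty is the gluing. A stratified bundle need not be locally trivial, and the fiber maps of
the attaching maps need not be invertible, so the continuity of ψ(hᵢ, h'ᵢ) is not a local matter.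
The set of pairs (b, v) gets the final topology for ψ(X₀, X'₀) and all ψ(Mᵢ, M'ᵢ). The main point
(`StratTotal.isClosed_of_char`) is that a set over `filt (i + 1)` which is closed when seen from
ψ(Mᵢ, M'ᵢ) and over `filt i` has closed preimage in every ψ(Mⱼ, M'ⱼ); hence the final topology is
that of successive attaching.

CW-complexes are sequential and the fibers are locally compact and first countable, so the bundles
ψ(Mⱼ, M'ⱼ) are sequential and closedness can be tested on sequences. Take a convergent sequence in
ψ(Mⱼ, M'ⱼ) whose images come from ψ(Mᵢ, M'ᵢ) outside Aᵢ. Trivialize near its limit: finitely many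
basis vectors yield convergent sequences in X and X', and these lift, after passage to a
subsequence, to convergent sequences in Mᵢ and M'ᵢ (`IsAttached.liftsSequences`). In trivializations
of Mᵢ and M'ᵢ the lifts form morphisms of V and V' which converge to linear maps lying only in the
closures. Here regularity enters: the extension of ψ to the closures produces the limit in ψ(Mᵢ,
M'ᵢ), and its functoriality identifies the image of that limit (`exists_subseq_tendsto_bimap`).

Functoriality holds because maps of families are determined by their fiber maps. The operations ⊕
and ⊗ are regular because the same formulas, linear resp. bilinear in the morphisms, make sense on
the closures. -/

theorem exists_lift_tendsto_of_isOpenEmbedding {X Y : Type*} [TopologicalSpace X]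
    [TopologicalSpace Y] {f : Y → X} (hf : IsOpenEmbedding f) {x : ℕ → X} {y : Y}
    (hx : Tendsto x atTop (𝓝 (f y))) :
    ∃ N, ∃ y' : ℕ → Y, Tendsto y' atTop (𝓝 y) ∧ ∀ n, f (y' n) = x (n + N) := by
  obtain ⟨N, hN⟩ := eventually_atTop.1 (hx.eventually (hf.isOpen_range.mem_nhds ⟨y, rfl⟩))
  choose y' hy' using fun n => hN (n + N) (Nat.le_add_left N n)
  refine ⟨N, y', ?_, hy'⟩
  rw [hf.isInducing.tendsto_nhds_iff]
  exact ((tendsto_add_atTop_iff_nat N).2 hx).congr fun n => (hy' n).symm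

theorem sequentialSpace_of_isOpenEmbedding {X Y : Type*} [TopologicalSpace X]
    [TopologicalSpace Y] [SequentialSpace X] {f : Y → X} (hf : IsOpenEmbedding f) :
    SequentialSpace Y := by
  refine ⟨fun K hK => ?_⟩
  have h : IsClosed (f '' Kᶜ)ᶜ := by
    refine IsSeqClosed.isClosed fun x z hx hz hzf => ?_
    obtain ⟨y, hy, rfl⟩ := hzf
    obtain ⟨N, y', hy', hy'x⟩ := exists_lift_tendsto_of_isOpenEmbedding hf hz
    refine hy (hK (fun n => ?_) hy')
    by_contra hn
    exact hx (n + N) ⟨y' n, hn, hy'x n⟩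
  have := h.preimage hf.continuous
  rwa [preimage_compl, preimage_image_eq _ hf.injective, compl_compl] at this

/-- A tube argument: a point outside a sequentially closed `C` has a compact neighborhood `K` in its
slice missing `C`. The projection of `C ∩ (X × K)` to `X` is sequentially closed because `K` is
sequentially compact, so it is closed and misses `x₀`. -/
theorem sequentialSpace_prod {X Y : Type*} [TopologicalSpace X] [TopologicalSpace Y]
    [SequentialSpace X] [LocallyCompactSpace Y] [FirstCountableTopology Y] :
    SequentialSpace (X × Y) := by
  refine ⟨fun C hC => ⟨isOpen_iff_mem_nhds.2 ?_⟩⟩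
  rintro ⟨x₀, y₀⟩ h₀
  have hslice : IsClosed {y | (x₀, y) ∈ C} :=
    IsSeqClosed.isClosed fun y y' hy hy' => hC hy (tendsto_const_nhds.prodMk_nhds hy')
  obtain ⟨K, hK, hKs, hKc⟩ := local_compact_nhds (hslice.isOpen_compl.mem_nhds h₀)
  have hW : IsClosed {x | ∃ y ∈ K, (x, y) ∈ C} := by
    refine IsSeqClosed.isClosed fun x x' hx hx' => ?_
    choose y hyK hyC using hx
    obtain ⟨y', hy', k, hk, hyk⟩ := hKc.isSeqCompact hyK
    exact ⟨y', hy', hC (fun n => hyC (k n)) ((hx'.comp hk.tendsto_atTop).prodMk_nhds hyk)⟩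
  have : x₀ ∉ {x | ∃ y ∈ K, (x, y) ∈ C} := fun ⟨y, hy, hC'⟩ => hKs hy hC'
  filter_upwards [prod_mem_nhds (hW.isOpen_compl.mem_nhds this) hK] with q hq hqC
  exact hq.1 ⟨q.2, hq.2, hqC⟩

/-- Closedness is tested on closed cells, and these are images of compact metrizable balls, on which
sequences suffice. -/
theorem sequentialSpace_of_cwComplex {M : Type u} [TopologicalSpace M] [T2Space M]
    [CWComplex (univ : Set M)] : SequentialSpace M := by
  refine ⟨fun S hS => ?_⟩
  rw [CWComplex.closed univ S (subset_univ _)]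
  intro n j
  have hc := RelCWComplex.continuousOn (C := (univ : Set M)) n j
  have hcl : IsClosed ((Metric.closedBall 0 1 : Set (Fin n → ℝ)).domRestrict
      (RelCWComplex.map (C := (univ : Set M)) n j) ⁻¹' S) :=
    IsSeqClosed.isClosed
      (hS.preimage (continuousOn_iff_continuous_domRestrict.1 hc).seqContinuous)
  have : CompactSpace (Metric.closedBall 0 1 : Set (Fin n → ℝ)) :=
    isCompact_iff_compactSpace.1 (isCompact_closedBall _ _)
  have := (hcl.isCompact.image (continuousOn_iff_continuous_domRestrict.1 hc)).isClosed
  rwa [image_preimage_eq_inter_range, range_domRestrict] at this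

theorem IsCWSpace.sequentialSpace {M : Type u} [TopologicalSpace M] (h : IsCWSpace M) :
    SequentialSpace M :=
  have := h.1
  have := h.2.some
  sequentialSpace_of_cwComplex

theorem IsCWPair.isCWSpace {M : Type u} [TopologicalSpace M] {A : Set M} (h : IsCWPair M A) :
    IsCWSpace M :=
  ⟨h.1, ⟨h.2.choose⟩⟩

theorem IsCWPair.isClosed {M : Type u} [TopologicalSpace M] {A : Set M} (h : IsCWPair M A) :
    IsClosed A := by
  obtain ⟨_, _, E, rfl⟩ := h
  exact E.closed'

/-- Finitely many properties of sequences, each of which can be achieved by passing to a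
subsequence, can be achieved simultaneously. -/
theorem exists_common_subseq {ι : Type*} [Finite ι] {P : ι → (ℕ → ℕ) → Prop}
    (hsub : ∀ i (k l : ℕ → ℕ), P i k → StrictMono l → P i (k ∘ l))
    (hex : ∀ i (k : ℕ → ℕ), StrictMono k → ∃ l : ℕ → ℕ, StrictMono l ∧ P i (k ∘ l)) :
    ∃ k : ℕ → ℕ, StrictMono k ∧ ∀ i, P i k := by
  classical
  cases nonempty_fintype ι
  suffices ∀ s : Finset ι, ∃ k : ℕ → ℕ, StrictMono k ∧ ∀ i ∈ s, P i k by
    simpa using this Finset.univ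
  intro s
  induction s using Finset.induction_on with
  | empty => exact ⟨id, strictMono_id, by simp⟩
  | insert i s _ ih =>
    obtain ⟨k, hk, hP⟩ := ih
    obtain ⟨l, hl, hPl⟩ := hex i k hk
    refine ⟨k ∘ l, hk.comp hl, fun j hj => ?_⟩
    obtain rfl | hj := Finset.mem_insert.1 hj
    · exact hPl
    · exact hsub _ _ _ (hP j hj) hl

/-! ### Convergence in adjunction spaces -/

theorem exists_subseq_eq_of_frequently {M : Type*} [TopologicalSpace M] {x : ℕ → M} {y : M}
    (h : ∃ᶠ n in atTop, x n = y) : ∃ k : ℕ → ℕ, StrictMono k ∧ Tendsto (x ∘ k) atTop (𝓝 y) := by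
  obtain ⟨k, hk, hkx⟩ := extraction_of_frequently_atTop h
  exact ⟨k, hk, tendsto_const_nhds.congr fun n => (hkx n).symm⟩

theorem IsAttached.mapsTo_univ {Z M : Type u} [TopologicalSpace Z] [TopologicalSpace M]
    {Z₀ Z₁ : Set Z} {A : Set M} {c : M → Z} (h : IsAttached Z₀ Z₁ A c) (x : M) : c x ∈ Z₁ := by
  by_cases hx : x ∈ A
  · exact h.subset (h.mapsTo hx)
  · exact (h.bijOn.mapsTo hx).1

/-- The lifting property of sequences for a map `c : M → Z` which is injective outside `A`. -/
def LiftsSequences {Z M : Type*} [TopologicalSpace Z] [TopologicalSpace M] (A : Set M)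
    (c : M → Z) : Prop :=
  ∀ (x : ℕ → M) (z : Z), (∀ n, x n ∉ A) → Tendsto (fun n => c (x n)) atTop (𝓝 z) →
    ∃ k : ℕ → ℕ, StrictMono k ∧ ∃ y, Tendsto (fun n => x (k n)) atTop (𝓝 y) ∧ c y = z

/-- Treats the inclusion of the bottom stratum on the same footing as the characteristic maps. -/
theorem isClosedEmbedding_liftsSequences {Z M : Type*} [TopologicalSpace Z] [TopologicalSpace M]
    {c : M → Z} (h : IsClosedEmbedding c) (A : Set M) : LiftsSequences A c := by
  intro x z _ hz
  obtain ⟨y, rfl⟩ := h.isClosed_range.mem_of_tendsto hz (Eventually.of_forall fun n => ⟨x n, rfl⟩)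
  exact ⟨id, strictMono_id, y, (h.isInducing.tendsto_nhds_iff).2 hz, rfl⟩

/-- If no subsequence of `x` converged, the tails of `x` would be closed in `M`, and so would their
images in `Z`, since outside `A` the map `c` is injective and avoids `Z₀`. Then `z` would lie in the
image of every tail, and injectivity would make `x` constant along a subsequence. The same argument,
with the limit `y` added to the tails, shows `c y = z`. Only points of `Z` need to be closed; `Z` is
not known to be Hausdorff. -/
theorem IsAttached.liftsSequences {Z M : Type u} [TopologicalSpace Z] [TopologicalSpace M]
    [T1Space Z] [T2Space M] [SequentialSpace M]
    {Z₀ Z₁ : Set Z} {A : Set M} {c : M → Z} (h : IsAttached Z₀ Z₁ A c) (hZ₁ : IsClosed Z₁) :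
    LiftsSequences A c := by
  intro x z hx hz
  have hinj : ∀ m n, c (x m) = c (x n) → x m = x n := fun m n e =>
    h.bijOn.injOn (hx m) (hx n) e
  have hZx : ∀ n, c (x n) ∉ Z₀ := fun n => (h.bijOn.mapsTo (hx n)).2
  have hpre : ∀ n w, c w = c (x n) → w = x n := by
    intro n w e
    by_cases hw : w ∈ A
    · exact absurd (e ▸ h.mapsTo hw) (hZx n)
    · exact h.bijOn.injOn hw (hx n) e
  have hclosed : ∀ S : Set Z, S ⊆ Z₁ → IsClosed (c ⁻¹' S) → IsClosed ((↑) ⁻¹' S : Set Z₀) →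
      IsClosed S := fun S hS h1 h2 => by
    have := (h.isClosed_iff S hS).2 ⟨h1, h2⟩
    have := hZ₁.isClosedEmbedding_subtypeVal.isClosedMap _ this
    rwa [Subtype.image_preimage_coe, inter_eq_self_of_subset_right hS] at this
  have key : ∃ k : ℕ → ℕ, StrictMono k ∧ ∃ y, Tendsto (x ∘ k) atTop (𝓝 y) := by
    by_contra! hno
    have hfreq : ∀ N, ∃ n ≥ N, c (x n) = z := by
      intro N
      have hT : IsClosed (range fun n => x (n + N)) :=
        isClosed_range_of_not_tendsto fun y k hk hy =>
          hno (fun n => k n + N) (fun a b hab => Nat.add_lt_add_right (hk hab) N) y hy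
      have hcT : IsClosed (c '' range fun n => x (n + N)) := by
        refine hclosed _ (by rintro _ ⟨w, _, rfl⟩; exact h.mapsTo_univ w) ?_ ?_
        · convert hT using 1
          ext w
          constructor
          · rintro ⟨_, ⟨n, rfl⟩, e⟩
            exact ⟨n, (hpre _ _ e.symm).symm⟩
          · exact fun hw => ⟨w, hw, rfl⟩
        · convert isClosed_empty
          refine eq_empty_of_forall_notMem ?_
          rintro w ⟨_, ⟨n, rfl⟩, e⟩
          exact hZx _ (e ▸ w.2)
      obtain ⟨_, ⟨n, rfl⟩, e⟩ := hcT.mem_of_tendsto ((tendsto_add_atTop_iff_nat N).2 hz)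
        (Eventually.of_forall fun n => ⟨_, ⟨n, rfl⟩, rfl⟩)
      exact ⟨n + N, Nat.le_add_left _ _, e⟩
    obtain ⟨a, -, ha⟩ := hfreq 0
    obtain ⟨k, hk, hkx⟩ := exists_subseq_eq_of_frequently (x := x) (y := x a)
      (frequently_atTop.2 fun N =>
        let ⟨n, hn, e⟩ := hfreq N
        ⟨n, hn, hinj _ _ (e.trans ha.symm)⟩)
    exact hno k hk _ hkx
  obtain ⟨k, hk, y, hy⟩ := key
  refine ⟨k, hk, y, hy, ?_⟩
  by_contra hne
  have hzk := hz.comp hk.tendsto_atTop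
  have hfreq : ∀ N, ∃ n ≥ N, c (x (k n)) = z := by
    intro N
    have hyN := (tendsto_add_atTop_iff_nat N).2 hy
    have hT : IsClosed (insert y (range fun n => (x ∘ k) (n + N))) :=
      hyN.isCompact_insert_range.isClosed
    have hcT : IsClosed (c '' insert y (range fun n => (x ∘ k) (n + N))) := by
      refine hclosed _ (by rintro _ ⟨w, _, rfl⟩; exact h.mapsTo_univ w) ?_ ?_
      -- If `y ∈ A`, the point `c y` may have further preimages, so the whole fiber over it has to
      -- be added.
      · convert hT.union ((isClosed_singleton (x := c y)).preimage h.continuous) using 1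
        ext w
        constructor
        · rintro ⟨_, rfl | ⟨n, rfl⟩, e⟩
          · exact Or.inr e.symm
          · exact Or.inl (Or.inr ⟨n, (hpre _ _ e.symm).symm⟩)
        · rintro (hw | hw)
          · exact ⟨w, hw, rfl⟩
          · exact ⟨y, Or.inl rfl, hw.symm⟩
      -- Inside `Z₀` only the point `c y` can occur.
      · refine Subsingleton.isClosed fun w hw w' hw' => Subtype.ext ?_
        obtain ⟨_, rfl | ⟨n, rfl⟩, e⟩ := hw
        · obtain ⟨_, rfl | ⟨n, rfl⟩, e'⟩ := hw'
          · exact e.symm.trans e'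
          · exact absurd (e' ▸ w'.2) (hZx _)
        · exact absurd (e ▸ w.2) (hZx _)
    obtain ⟨_, rfl | ⟨n, rfl⟩, e⟩ := hcT.mem_of_tendsto ((tendsto_add_atTop_iff_nat N).2 hzk)
      (Eventually.of_forall fun n => ⟨_, Or.inr ⟨n, rfl⟩, rfl⟩)
    · exact absurd e hne
    · exact ⟨n + N, Nat.le_add_left _ _, e⟩
  obtain ⟨a, -, ha⟩ := hfreq 0
  obtain ⟨l, hl, hlx⟩ := exists_subseq_eq_of_frequently (x := x ∘ k) (y := x (k a))
    (frequently_atTop.2 fun N =>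
      let ⟨n, hn, e⟩ := hfreq N
      ⟨n, hn, hinj _ _ (e.trans ha.symm)⟩)
  exact hne ((tendsto_nhds_unique (hy.comp hl.tendsto_atTop) hlx) ▸ ha)

end StratBdl

namespace StratBdl

open Filter Set

/-! ### Topologies of finite-dimensional vector spaces -/

noncomputable def homeomorphPi (X : FGModuleCat.{u} ℝ) :
    X ≃ₜ (Module.Free.ChooseBasisIndex ℝ X → ℝ) where
  toEquiv := (Module.Free.chooseBasis ℝ X).equivFun.toEquiv
  continuous_toFun :=
    IsModuleTopology.continuous_of_linearMap (Module.Free.chooseBasis ℝ X).equivFun.toLinearMap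
  continuous_invFun :=
    have := IsModuleTopology.toContinuousAdd ℝ X
    IsModuleTopology.continuous_of_linearMap (Module.Free.chooseBasis ℝ X).equivFun.symm.toLinearMap

instance (X : FGModuleCat.{u} ℝ) : T2Space X := (homeomorphPi X).isEmbedding.t2Space

instance (X : FGModuleCat.{u} ℝ) : FirstCountableTopology X :=
  (homeomorphPi X).isInducing.firstCountableTopology

instance (X : FGModuleCat.{u} ℝ) : LocallyCompactSpace X :=
  (homeomorphPi X).isClosedEmbedding.locallyCompactSpace

theorem continuous_lin {X Y : FGModuleCat.{u} ℝ} (f : X →ₗ[ℝ] Y) : Continuous f :=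
  have := IsModuleTopology.toContinuousAdd ℝ Y
  IsModuleTopology.continuous_of_linearMap f

theorem continuous_eval_lin (X Y : FGModuleCat.{u} ℝ) :
    letI := linTop X Y
    Continuous fun q : (X →ₗ[ℝ] Y) × X => q.1 q.2 := by
  let _ := linTop X Y
  have : IsModuleTopology ℝ (X →ₗ[ℝ] Y) := ⟨rfl⟩
  exact IsModuleTopology.continuous_bilinear_of_finite_left
    (LinearMap.id : (X →ₗ[ℝ] Y) →ₗ[ℝ] (X →ₗ[ℝ] Y))

/-- Convergence of linear maps can be tested on a basis. -/
theorem tendsto_lin_of_basis {X Y : FGModuleCat.{u} ℝ} {κ : Type*} [Finite κ]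
    (b : Module.Basis κ ℝ X) {ι : Type*} {l : Filter ι} {f : ι → X →ₗ[ℝ] Y} {g : X →ₗ[ℝ] Y}
    (h : ∀ i, Tendsto (fun n => f n (b i)) l (𝓝 (g (b i)))) :
    Tendsto f l (@nhds _ (linTop X Y) g) := by
  let _ := linTop X Y
  have : IsModuleTopology ℝ (X →ₗ[ℝ] Y) := ⟨rfl⟩
  have := IsModuleTopology.toContinuousAdd ℝ (X →ₗ[ℝ] Y)
  have hc : Continuous (b.constr ℝ : (κ → Y) ≃ₗ[ℝ] (X →ₗ[ℝ] Y)) :=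
    IsModuleTopology.continuous_of_linearMap (b.constr ℝ : (κ → Y) ≃ₗ[ℝ] (X →ₗ[ℝ] Y)).toLinearMap
  have := (hc.tendsto fun i => g (b i)).comp (tendsto_pi_nhds.2 h)
  have e : ∀ f : X →ₗ[ℝ] Y, b.constr ℝ (fun i => f (b i)) = f := fun f =>
    (b.constr ℝ).apply_symm_apply f
  rw [e] at this
  exact this.congr fun n => e (f n)

/-! ### Morphism spaces of a structure category -/

section Hom

variable {V : StructureCategory.{u}}

@[simp]
theorem toLin_id (X : V.Ob) : toLin (𝟙 X) = LinearMap.id := rfl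

@[simp]
theorem toLin_comp {X Y Z : V.Ob} (f : X ⟶ Y) (g : Y ⟶ Z) :
    toLin (f ≫ g) = toLin g ∘ₗ toLin f := rfl

theorem hom_ext {X Y : V.Ob} {f g : X ⟶ Y} (h : ∀ v, toLin f v = toLin g v) : f = g :=
  Subtype.ext (LinearMap.ext h)

@[simp]
theorem toLin_hom_inv {X Y : V.Ob} (e : X ≅ Y) (y : Y) : toLin e.hom (toLin e.inv y) = y := by
  rw [← LinearMap.comp_apply, ← toLin_comp, e.inv_hom_id, toLin_id, LinearMap.id_apply]

@[simp]
theorem toLin_inv_hom {X Y : V.Ob} (e : X ≅ Y) (x : X) : toLin e.inv (toLin e.hom x) = x := by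
  rw [← LinearMap.comp_apply, ← toLin_comp, e.hom_inv_id, toLin_id, LinearMap.id_apply]

theorem isInducing_toLin (X Y : V.Ob) :
    letI := linTop X.carrier Y.carrier
    IsInducing (toLin : (X ⟶ Y) → _) :=
  letI := linTop X.carrier Y.carrier
  ⟨rfl⟩

theorem continuous_eval (X Y : V.Ob) :
    Continuous fun q : (X ⟶ Y) × X => toLin q.1 q.2 := by
  let _ := linTop X.carrier Y.carrier
  exact (continuous_eval_lin X.carrier Y.carrier).comp
    ((isInducing_toLin X Y).continuous.prodMap continuous_id)

theorem continuous_comp_hom (X Y Z : V.Ob) :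
    Continuous fun q : (X ⟶ Y) × (Y ⟶ Z) => q.1 ≫ q.2 := by
  let _ := linTop X.carrier Y.carrier
  let _ := linTop Y.carrier Z.carrier
  let _ := linTop X.carrier Z.carrier
  rw [(isInducing_toLin X Z).continuous_iff]
  exact (continuous_comp_lin X.carrier Y.carrier Z.carrier).comp
    ((isInducing_toLin X Y).continuous.prodMap (isInducing_toLin Y Z).continuous)

theorem tendsto_hom_of_basis {X Y : V.Ob} {κ : Type*} [Finite κ]
    (b : Module.Basis κ ℝ X) {ι : Type*} {l : Filter ι} {f : ι → (X ⟶ Y)} {g : X ⟶ Y}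
    (h : ∀ i, Tendsto (fun n => toLin (f n) (b i)) l (𝓝 (toLin g (b i)))) :
    Tendsto f l (𝓝 g) := by
  let _ := linTop X.carrier Y.carrier
  rw [(isInducing_toLin X Y).tendsto_nhds_iff]
  exact tendsto_lin_of_basis b h

theorem tendsto_hom {X Y : V.Ob} {ι : Type*} {l : Filter ι} {f : ι → (X ⟶ Y)} {g : X ⟶ Y}
    (h : ∀ v, Tendsto (fun n => toLin (f n) v) l (𝓝 (toLin g v))) :
    Tendsto f l (𝓝 g) :=
  tendsto_hom_of_basis (Module.Free.chooseBasis ℝ X) fun _ => h _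

theorem continuous_hom {X Y : V.Ob} {T : Type*} [TopologicalSpace T] {f : T → (X ⟶ Y)}
    (h : ∀ v, Continuous fun t => toLin (f t) v) : Continuous f :=
  continuous_iff_continuousAt.2 fun t => tendsto_hom fun v => (h v).tendsto t

/-- The homeomorphism given by an isomorphism of a structure category. -/
def homeomorphOfIso {X Y : V.Ob} (e : X ≅ Y) : X ≃ₜ Y where
  toFun := toLin e.hom
  invFun := toLin e.inv
  left_inv := toLin_inv_hom e
  right_inv := toLin_hom_inv e
  continuous_toFun := continuous_lin _
  continuous_invFun := continuous_lin _

end Hom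

/-! ### Continuous bifunctors -/

section Bifunctor

variable {V V' W : StructureCategory.{u}}

/-- The morphism of `W` obtained by applying a bifunctor to two morphisms. -/
abbrev bimap (ψ : V.Ob × V'.Ob ⥤ W.Ob) {X Y : V.Ob} {X' Y' : V'.Ob} (f : X ⟶ Y) (f' : X' ⟶ Y') :
    ψ.obj (X, X') ⟶ ψ.obj (Y, Y') :=
  ψ.map (Prod.mkHom f f')

theorem bimap_id (ψ : V.Ob × V'.Ob ⥤ W.Ob) (X : V.Ob) (X' : V'.Ob) :
    bimap ψ (𝟙 X) (𝟙 X') = 𝟙 _ := ψ.map_id (X, X')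

theorem bimap_comp (ψ : V.Ob × V'.Ob ⥤ W.Ob) {X Y Z : V.Ob} {X' Y' Z' : V'.Ob}
    (f : X ⟶ Y) (f' : X' ⟶ Y') (g : Y ⟶ Z) (g' : Y' ⟶ Z') :
    bimap ψ (f ≫ g) (f' ≫ g') = bimap ψ f f' ≫ bimap ψ g g' :=
  ψ.map_comp (Prod.mkHom f f') (Prod.mkHom g g')

/-- The isomorphism of `W` obtained by applying a bifunctor to two isomorphisms. -/
abbrev bimapIso (ψ : V.Ob × V'.Ob ⥤ W.Ob) {X Y : V.Ob} {X' Y' : V'.Ob} (e : X ≅ Y) (e' : X' ≅ Y') :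
    ψ.obj (X, X') ≅ ψ.obj (Y, Y') :=
  ψ.mapIso (e.prod e')

/-- A continuous extension of a bifunctor to the closures of the structure categories which has
the same values on objects. -/
structure ClosureExtension (ψ : V.Ob × V'.Ob ⥤ W.Ob) where
  map : ∀ {X Y : V.Ob} {X' Y' : V'.Ob}, (V.incl.obj X ⟶ V.incl.obj Y) →
    (V'.incl.obj X' ⟶ V'.incl.obj Y') → (W.incl.obj (ψ.obj (X, X')) ⟶ W.incl.obj (ψ.obj (Y, Y')))
  continuous_map : ∀ {X Y : V.Ob} {X' Y' : V'.Ob},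
    Continuous fun q : (V.incl.obj X ⟶ V.incl.obj Y) × (V'.incl.obj X' ⟶ V'.incl.obj Y') =>
      map q.1 q.2
  map_comp : ∀ {X Y Z : V.Ob} {X' Y' Z' : V'.Ob} (f : V.incl.obj X ⟶ V.incl.obj Y)
    (f' : V'.incl.obj X' ⟶ V'.incl.obj Y') (g : V.incl.obj Y ⟶ V.incl.obj Z)
    (g' : V'.incl.obj Y' ⟶ V'.incl.obj Z'), map (f ≫ g) (f' ≫ g') = map f f' ≫ map g g'
  map_incl : ∀ {X Y : V.Ob} {X' Y' : V'.Ob} (f : X ⟶ Y) (f' : X' ⟶ Y'),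
    map (V.incl.map f) (V'.incl.map f') = W.incl.map (bimap ψ f f')

/-- Regularity gives an equality of functors, under which the objects Ψ(X, X') and ψ(X, X') are
equal only propositionally. Conjugation with the resulting natural isomorphism makes the values on
objects agree definitionally, and it preserves continuity and functoriality. -/
theorem IsRegularContinuous.exists_closureExtension {ψ : V.Ob × V'.Ob ⥤ W.Ob}
    (hψ : IsRegularContinuous ψ) : Nonempty (ClosureExtension ψ) := by
  obtain ⟨-, Ψ, hΨ, h⟩ := hψ
  let η : V.incl.prod V'.incl ⋙ Ψ ≅ ψ ⋙ W.incl := eqToIso h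
  refine ⟨⟨fun {X Y X' Y'} f f' => η.inv.app (X, X') ≫ bimap Ψ f f' ≫ η.hom.app (Y, Y'),
    ?_, ?_, ?_⟩⟩
  · intro X Y X' Y'
    exact (continuous_comp_hom _ _ _).comp (continuous_const.prodMk
      ((continuous_comp_hom _ _ _).comp ((hΨ _ _ _ _).prodMk continuous_const)))
  · intros
    rw [bimap_comp]
    have (X : V.Ob × V'.Ob) := η.hom_inv_id_app X
    simp only [Category.assoc]
    rw [reassoc_of% this]
  · intro X Y X' Y' f f'
    have h1 := η.hom.naturality (Prod.mkHom f f' : (X, X') ⟶ (Y, Y'))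
    have h2 := η.inv_hom_id_app (X, X')
    have h3 : bimap Ψ (V.incl.map f) (V'.incl.map f') =
      (V.incl.prod V'.incl ⋙ Ψ).map (Prod.mkHom f f' : (X, X') ⟶ (Y, Y')) := rfl
    rw [h3]
    erw [h1]
    rw [← Category.assoc, h2]
    exact Category.id_comp _

end Bifunctor

end StratBdl

namespace StratBdl

open Filter Set

/-! ### Families and trivializations -/

section Families

variable {V : StructureCategory.{u}} {B : Type u} [TopologicalSpace B] {fib : B → V.Ob}

namespace VFamily

@[simp]
theorem proj_emb (X : VFamily V B fib) (b : B) (v : fib b) : X.proj (X.emb b v) = b :=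
  ((X.chart b).symm v).2

theorem isEmbedding_emb (X : VFamily V B fib) (b : B) : IsEmbedding (X.emb b) :=
  IsEmbedding.subtypeVal.comp (X.chart b).symm.isEmbedding

theorem exists_emb_eq (X : VFamily V B fib) (x : X.Total) : ∃ v, X.emb (X.proj x) v = x :=
  ⟨X.chart (X.proj x) ⟨x, rfl⟩, by simp [emb]⟩

/-- The family with total space `E` and fibers embedded by the maps `emb`. -/
noncomputable def ofFibers (E : Type u) [TopologicalSpace E] (p : E → B) (hp : Continuous p)
    (emb : ∀ b, fib b → E) (hemb : ∀ b, IsEmbedding (emb b))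
    (hrange : ∀ b, range (emb b) = p ⁻¹' {b}) : VFamily V B fib where
  Total := E
  proj := p
  continuous_proj := hp
  chart b := ((hemb b).toHomeomorph.trans (Homeomorph.setCongr (hrange b))).symm

/-- Isomorphisms `V₀ ≅ fib (g t)` which define an embedding of `T × V₀` into the total space. -/
def Triv (X : VFamily V B fib) {T : Type u} [TopologicalSpace T] (g : T → B) (V₀ : V.Ob)
    (e : ∀ t, V₀ ≅ fib (g t)) : Prop :=
  IsEmbedding fun q : T × V₀ => X.emb (g q.1) (toLin (e q.1).hom q.2)

theorem Triv.comp {X : VFamily V B fib} {T T' : Type u} [TopologicalSpace T] [TopologicalSpace T']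
    {g : T → B} {V₀ : V.Ob} {e : ∀ t, V₀ ≅ fib (g t)} (h : X.Triv g V₀ e) {s : T' → T}
    (hs : IsEmbedding s) : X.Triv (fun t => g (s t)) V₀ fun t => e (s t) :=
  IsEmbedding.comp h (hs.prodMap IsEmbedding.id)

theorem Triv.continuous_base {X : VFamily V B fib} {T : Type u} [TopologicalSpace T]
    {g : T → B} {V₀ : V.Ob} {e : ∀ t, V₀ ≅ fib (g t)} (h : X.Triv g V₀ e) : Continuous g := by
  have := X.continuous_proj.comp (h.continuous.comp (continuous_id.prodMk
    (continuous_const (y := (0 : V₀)))))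
  exact this.congr fun t => X.proj_emb _ _

/-- Read in a trivialization, a continuous family of vectors is continuous. -/
theorem Triv.tendsto_coord {X : VFamily V B fib} {T : Type u} [TopologicalSpace T]
    {g : T → B} {V₀ : V.Ob} {e : ∀ t, V₀ ≅ fib (g t)} (h : X.Triv g V₀ e) {ι : Type*}
    {l : Filter ι} {s : ι → T} {s₀ : T} {u : ∀ i, fib (g (s i))} {u₀ : fib (g s₀)}
    (hu : Tendsto (fun i => X.emb (g (s i)) (u i)) l (𝓝 (X.emb (g s₀) u₀))) :
    Tendsto s l (𝓝 s₀) ∧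
      Tendsto (fun i => toLin (e (s i)).inv (u i)) l (𝓝 (toLin (e s₀).inv u₀)) := by
  have := (h.isInducing.tendsto_nhds_iff (f := fun i => (s i, toLin (e (s i)).inv (u i)))
    (y := (s₀, toLin (e s₀).inv u₀))).2 (by simpa [Function.comp_def] using hu)
  exact ⟨this.fst_nhds, this.snd_nhds⟩

/-- The source of all continuous transition functions: as the fibers are finite-dimensional,
continuity into a morphism space may be tested on one vector at a time. -/
theorem Triv.continuous_coord {X : VFamily V B fib} {T : Type u} [TopologicalSpace T]
    {g : T → B} {V₀ V₁ : V.Ob} {e : ∀ t, V₀ ≅ fib (g t)} (h : X.Triv g V₀ e) {T' : Type*}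
    [TopologicalSpace T'] {s : T' → T} {k : ∀ t, V₁ ⟶ fib (g (s t))}
    (hk : ∀ v, Continuous fun t => X.emb (g (s t)) (toLin (k t) v)) :
    Continuous fun t => k t ≫ (e (s t)).inv :=
  continuous_hom fun v => continuous_iff_continuousAt.2 fun t =>
    (h.tendsto_coord ((hk v).tendsto t)).2

/-- The restriction of a family to a subspace of the base. -/
def restrict (X : VFamily V B fib) (C : Set B) : VFamily V C fun b => fib b where
  Total := X.proj ⁻¹' C
  proj x := ⟨X.proj x, x.2⟩
  continuous_proj := (X.continuous_proj.comp continuous_subtype_val).subtype_mk _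
  chart b :=
    { toFun x := X.chart b ⟨x.1.1, congrArg Subtype.val x.2⟩
      invFun v := ⟨⟨X.emb b v, by simp [b.2]⟩, Subtype.ext (X.proj_emb _ _)⟩
      left_inv x := by simp [emb]
      right_inv v := by simp [emb]
      continuous_toFun := by fun_prop
      continuous_invFun := by
        have := (X.isEmbedding_emb b).continuous
        fun_prop }

theorem triv_restrict_iff {X : VFamily V B fib} {C : Set B} {T : Type u} [TopologicalSpace T]
    {g : T → C} {V₀ : V.Ob} {e : ∀ t, V₀ ≅ fib (g t)} :
    (X.restrict C).Triv g V₀ e ↔ X.Triv (fun t => (g t).1) V₀ e :=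
  (IsEmbedding.of_comp_iff (f := fun q : T × V₀ => (X.restrict C).emb (g q.1)
    (toLin (e q.1).hom q.2)) (IsEmbedding.subtypeVal (p := fun x => x ∈ X.proj ⁻¹' C))).symm

theorem IsBundleOn.restrict {X : VFamily V B fib} {C : Set B} (h : X.IsBundleOn C) :
    (X.restrict C).IsBundleOn univ := by
  rintro ⟨b, hb⟩ -
  obtain ⟨U, hU, hUC, V₀, e, he⟩ := h b hb
  refine ⟨(Subtype.val ⁻¹' U : Set C), ?_, subset_univ _, V₀, fun c => e ⟨c.1, c.2⟩, ?_⟩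
  · rw [nhdsWithin_univ]
    exact mem_nhds_subtype_iff_nhdsWithin.2 (by
      filter_upwards [hU] with x hx
      exact ⟨⟨x, hUC hx⟩, hx, rfl⟩)
  · have he' : X.Triv (Subtype.val : U → B) V₀ e := he
    have hs : IsEmbedding (fun c : (Subtype.val ⁻¹' U : Set C) => (⟨c.1, c.2⟩ : U)) :=
      (IsEmbedding.of_comp_iff (IsEmbedding.subtypeVal (p := fun x => x ∈ U))).1
        ((IsEmbedding.subtypeVal (p := fun x => x ∈ C)).comp IsEmbedding.subtypeVal)
    exact (triv_restrict_iff (g := fun c : (Subtype.val ⁻¹' U : Set C) => c.1)).2 (he'.comp hs)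

theorem IsBundleOn.exists_triv {V' : StructureCategory.{u}} {fib' : B → V'.Ob}
    {X : VFamily V B fib} {X' : VFamily V' B fib'}
    (h : X.IsBundleOn univ) (h' : X'.IsBundleOn univ) {b : B} {O : Set B} (hO : O ∈ 𝓝 b) :
    ∃ N : Set B, IsOpen N ∧ b ∈ N ∧ N ⊆ O ∧ ∃ (V₀ : V.Ob) (e : ∀ c : N, V₀ ≅ fib c)
      (V₀' : V'.Ob) (e' : ∀ c : N, V₀' ≅ fib' c), X.Triv (Subtype.val : N → B) V₀ e ∧
        X'.Triv (Subtype.val : N → B) V₀' e' := by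
  obtain ⟨U, hU, -, V₀, e, he⟩ := h b (mem_univ b)
  obtain ⟨U', hU', -, V₀', e', he'⟩ := h' b (mem_univ b)
  rw [nhdsWithin_univ] at hU hU'
  obtain ⟨N, hN, hNo, hb⟩ := mem_nhds_iff.1 (inter_mem hO (inter_mem hU hU'))
  have he₁ : X.Triv (Subtype.val : U → B) V₀ e := he
  have he₁' : X'.Triv (Subtype.val : U' → B) V₀' e' := he'
  exact ⟨N, hNo, hb, fun x hx => (hN hx).1, V₀, fun c => e ⟨c.1, (hN c.2).2.1⟩, V₀',
    fun c => e' ⟨c.1, (hN c.2).2.2⟩, he₁.comp (IsEmbedding.inclusion fun x hx => (hN hx).2.1),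
    he₁'.comp (IsEmbedding.inclusion fun x hx => (hN hx).2.2)⟩

theorem IsBundleOn.exists_triv_single {X : VFamily V B fib} (h : X.IsBundleOn univ) (b : B) :
    ∃ N : Set B, IsOpen N ∧ b ∈ N ∧ ∃ (V₀ : V.Ob) (e : ∀ c : N, V₀ ≅ fib c),
      X.Triv (Subtype.val : N → B) V₀ e := by
  obtain ⟨N, hN, hb, -, V₀, e, -, -, he, -⟩ := h.exists_triv h (b := b) univ_mem
  exact ⟨N, hN, hb, V₀, e, he⟩

theorem Triv.isOpenEmbedding {X : VFamily V B fib} {N : Set B} (hN : IsOpen N) {V₀ : V.Ob}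
    {e : ∀ c : N, V₀ ≅ fib c} (h : X.Triv (Subtype.val : N → B) V₀ e) :
    IsOpenEmbedding fun q : N × V₀ => X.emb q.1 (toLin (e q.1).hom q.2) := by
  refine ⟨h, ?_⟩
  convert hN.preimage X.continuous_proj using 1
  ext x
  constructor
  · rintro ⟨q, rfl⟩
    simp [q.1.2]
  · intro hx
    obtain ⟨v, hv⟩ := X.exists_emb_eq x
    exact ⟨(⟨X.proj x, hx⟩, toLin (e ⟨X.proj x, hx⟩).inv v), by simp [hv]⟩

theorem IsBundleOn.t2Space [T2Space B] {X : VFamily V B fib} (h : X.IsBundleOn univ) :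
    T2Space X.Total := by
  refine ⟨fun x y hxy => ?_⟩
  by_cases hp : X.proj x = X.proj y
  · obtain ⟨N, hN, hb, V₀, e, he⟩ := h.exists_triv_single (X.proj x)
    have hτ := he.isOpenEmbedding hN
    obtain ⟨v, hv⟩ := X.exists_emb_eq x
    obtain ⟨w, hw⟩ := X.exists_emb_eq y
    rw [← hv, ← hw] at hxy ⊢
    generalize X.proj x = b at *
    subst hp
    have hne : ((⟨_, hb⟩, toLin (e ⟨_, hb⟩).inv v) : N × V₀) ≠ (⟨_, hb⟩, toLin (e ⟨_, hb⟩).inv w) :=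
      fun h' => hxy (by simpa using congrArg (fun q : N × V₀ => X.emb q.1 (toLin (e q.1).hom q.2)) h')
    obtain ⟨s, t, hs, ht, h1, h2, hd⟩ := t2_separation hne
    exact ⟨_, _, hτ.isOpenMap _ hs, hτ.isOpenMap _ ht, ⟨_, h1, by simp⟩, ⟨_, h2, by simp⟩,
      (disjoint_image_iff hτ.injective).2 hd⟩
  · obtain ⟨s, t, hs, ht, h1, h2, hd⟩ := t2_separation hp
    exact ⟨_, _, hs.preimage X.continuous_proj, ht.preimage X.continuous_proj, h1, h2,
      hd.preimage _⟩

/-- Being sequential passes to open subsets of the base and to products with a finite-dimensional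
space, hence holds locally on the total space, which is enough. -/
theorem IsBundleOn.sequentialSpace [SequentialSpace B] {X : VFamily V B fib}
    (h : X.IsBundleOn univ) : SequentialSpace X.Total := by
  refine ⟨fun S hS => ⟨isOpen_iff_mem_nhds.2 fun x hx => ?_⟩⟩
  obtain ⟨N, hN, hb, V₀, e, he⟩ := h.exists_triv_single (X.proj x)
  have hτ := he.isOpenEmbedding hN
  have := sequentialSpace_of_isOpenEmbedding hN.isOpenEmbedding_subtypeVal
  have : SequentialSpace (N × V₀) := sequentialSpace_prod
  have hcl := (hS.preimage hτ.continuous.seqContinuous).isClosed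
  obtain ⟨v, hv⟩ := X.exists_emb_eq x
  have hx' : X.emb _ (toLin (e ⟨X.proj x, hb⟩).hom (toLin (e ⟨X.proj x, hb⟩).inv v)) = x := by
    simpa using hv
  have := hτ.isOpenMap.image_mem_nhds (hcl.isOpen_compl.mem_nhds
    (x := (⟨X.proj x, hb⟩, toLin (e ⟨X.proj x, hb⟩).inv v)) (by
      change X.emb _ _ ∉ S
      rw [hx']
      exact hx))
  rw [hx'] at this
  refine mem_of_superset this ?_
  rintro _ ⟨q, hq, rfl⟩
  exact hq

end VFamily

end Families

end StratBdl

namespace StratBdl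

open Filter Set

/-! ### The bundle obtained by applying a continuous bifunctor to two bundles -/

section Bifamily

variable {V V' W : StructureCategory.{u}} (ψ : V.Ob × V'.Ob ⥤ W.Ob)
  {B : Type u} [TopologicalSpace B] {fib : B → V.Ob} {fib' : B → V'.Ob}

/-- Change of coordinates: `bimap ψ k k'` read in the trivializations `e`, `e'` and then mapped
back. -/
theorem bimap_hom_inv {X Y : V.Ob} {X' Y' : V'.Ob} {Z : V.Ob} {Z' : V'.Ob}
    (k : Z ⟶ Y) (k' : Z' ⟶ Y') (e : X ≅ Y) (e' : X' ≅ Y') (w : ψ.obj (Z, Z')) :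
    toLin (bimap ψ e.hom e'.hom) (toLin (bimap ψ (k ≫ e.inv) (k' ≫ e'.inv)) w) =
      toLin (bimap ψ k k') w := by
  rw [← LinearMap.comp_apply, ← toLin_comp, ← bimap_comp]
  simp

theorem IsContinuousBifunctor.continuous_bimap {ψ : V.Ob × V'.Ob ⥤ W.Ob}
    (hψ : IsContinuousBifunctor ψ) {T : Type*} [TopologicalSpace T] {X Y : V.Ob} {X' Y' : V'.Ob}
    {k : T → (X ⟶ Y)} {k' : T → (X' ⟶ Y')} {w : T → ψ.obj (X, X')} (hk : Continuous k)
    (hk' : Continuous k') (hw : Continuous w) :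
    Continuous fun t => toLin (bimap ψ (k t) (k' t)) (w t) :=
  (continuous_eval _ _).comp (((hψ X Y X' Y').comp (hk.prodMk hk')).prodMk hw)

/-- The set of all pairs of a point `b` and a vector of `ψ(X_b, X'_b)`. -/
structure BiTotal (X : VFamily V B fib) (X' : VFamily V' B fib') : Type u where
  base : B
  vec : ψ.obj (fib base, fib' base)

variable (X : VFamily V B fib) (X' : VFamily V' B fib')

/-- The fiberwise image of two trivializations. -/
def biTriv {T : Type u} (g : T → B) {V₀ : V.Ob} {V₀' : V'.Ob} (e : ∀ t, V₀ ≅ fib (g t))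
    (e' : ∀ t, V₀' ≅ fib' (g t)) (q : T × ψ.obj (V₀, V₀')) : BiTotal ψ X X' :=
  ⟨g q.1, toLin (bimap ψ (e q.1).hom (e' q.1).hom) q.2⟩

/-- The final topology for the fiberwise images of all pairs of trivializations over open sets. It
is meaningful when both families are bundles over all of `B`. -/
instance : TopologicalSpace (BiTotal ψ X X') where
  IsOpen O := ∀ (N : Set B) (V₀ : V.Ob) (V₀' : V'.Ob) (e : ∀ b : N, V₀ ≅ fib b)
    (e' : ∀ b : N, V₀' ≅ fib' b), IsOpen N → X.Triv (Subtype.val : N → B) V₀ e →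
      X'.Triv (Subtype.val : N → B) V₀' e' → IsOpen (biTriv ψ X X' Subtype.val e e' ⁻¹' O)
  isOpen_univ _ _ _ _ _ _ _ _ := isOpen_univ
  isOpen_inter s t hs ht N V₀ V₀' e e' hN he he' :=
    (hs N V₀ V₀' e e' hN he he').inter (ht N V₀ V₀' e e' hN he he')
  isOpen_sUnion S hS N V₀ V₀' e e' hN he he' := by
    rw [preimage_sUnion]
    exact isOpen_biUnion fun t ht => hS t ht N V₀ V₀' e e' hN he he'

variable {ψ X X'}

theorem BiTotal.continuous_base : Continuous (BiTotal.base : BiTotal ψ X X' → B) :=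
  ⟨fun _ hO _ _ _ _ _ _ _ _ => hO.preimage (continuous_subtype_val.comp continuous_fst)⟩

theorem biTriv_injective {T : Type u} {g : T → B} (hg : Function.Injective g) {V₀ : V.Ob}
    {V₀' : V'.Ob} (e : ∀ t, V₀ ≅ fib (g t)) (e' : ∀ t, V₀' ≅ fib' (g t)) :
    Function.Injective (biTriv ψ X X' g e e') := by
  rintro ⟨t, w⟩ ⟨t', w'⟩ h
  obtain rfl : t = t' := hg (congrArg BiTotal.base h)
  have := eq_of_heq (BiTotal.mk.inj h).2
  exact congrArg (Prod.mk t) ((homeomorphOfIso (bimapIso ψ (e t) (e' t))).injective this)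

/-- On overlaps the transition map between two such charts is ψ of the two transition functions,
hence continuous. So the image of an open set under one chart pulls back to an open set in every
other chart. -/
theorem isOpenEmbedding_biTriv_of_isOpen (hψ : IsContinuousBifunctor ψ) {N : Set B}
    (hN : IsOpen N) {V₀ : V.Ob} {V₀' : V'.Ob} {e : ∀ b : N, V₀ ≅ fib b}
    {e' : ∀ b : N, V₀' ≅ fib' b} (he : X.Triv (Subtype.val : N → B) V₀ e)
    (he' : X'.Triv (Subtype.val : N → B) V₀' e') :
    IsOpenEmbedding (biTriv ψ X X' Subtype.val e e') := by
  refine IsOpenEmbedding.of_continuous_injective_isOpenMap ⟨fun O hO => hO N _ _ e e' hN he he'⟩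
    (biTriv_injective Subtype.val_injective e e') ?_
  intro O hO N₁ V₁ V₁' e₁ e₁' hN₁ he₁ he₁'
  let P : Set (N₁ × ψ.obj (V₁, V₁')) := {q | q.1.1 ∈ N}
  have hP : IsOpen P := hN.preimage (continuous_subtype_val.comp continuous_fst)
  let s : P → N := fun p => ⟨p.1.1.1, p.2⟩
  have hs : Continuous s := by fun_prop
  have hb : Continuous fun p : P => p.1.1 := by fun_prop
  have hk : Continuous fun p : P => (e₁ p.1.1).hom ≫ (e (s p)).inv :=
    he.continuous_coord (s := s) (k := fun p : P => (e₁ p.1.1).hom) fun v =>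
      he₁.continuous.comp (hb.prodMk continuous_const)
  have hk' : Continuous fun p : P => (e₁' p.1.1).hom ≫ (e' (s p)).inv :=
    he'.continuous_coord (s := s) (k := fun p : P => (e₁' p.1.1).hom) fun v =>
      he₁'.continuous.comp (hb.prodMk continuous_const)
  -- The transition map from the chart of `e₁`, `e₁'` to that of `e`, `e'`, defined over the
  -- overlap.
  have hρ : Continuous fun p : P => (s p, toLin (bimap ψ ((e₁ p.1.1).hom ≫ (e (s p)).inv)
      ((e₁' p.1.1).hom ≫ (e' (s p)).inv)) p.1.2) :=
    hs.prodMk (hψ.continuous_bimap hk hk' (by fun_prop))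
  have hρτ : ∀ p : P, biTriv ψ X X' Subtype.val e e' (s p, toLin (bimap ψ
      ((e₁ p.1.1).hom ≫ (e (s p)).inv) ((e₁' p.1.1).hom ≫ (e' (s p)).inv)) p.1.2) =
      biTriv ψ X X' Subtype.val e₁ e₁' p.1 := fun p =>
    congrArg (BiTotal.mk (p.1.1.1))
      (bimap_hom_inv ψ (e₁ p.1.1).hom (e₁' p.1.1).hom (e (s p)) (e' (s p)) p.1.2)
  convert hP.isOpenMap_subtype_val _ (hO.preimage hρ) using 1
  ext q
  constructor
  · rintro ⟨r, hr, hrq⟩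
    have hq : q.1.1 ∈ N := by
      have : r.1.1 = q.1.1 := congrArg BiTotal.base hrq
      exact this ▸ r.1.2
    refine ⟨⟨q, hq⟩, ?_, rfl⟩
    have := biTriv_injective Subtype.val_injective e e' ((hρτ ⟨q, hq⟩).trans hrq.symm)
    exact mem_preimage.2 (this ▸ hr)
  · rintro ⟨p, hp, rfl⟩
    exact ⟨_, hp, hρτ p⟩

/-- Continuity of maps into the total space. -/
theorem BiTotal.continuous_mk (hψ : IsContinuousBifunctor ψ) (hX : X.IsBundleOn univ)
    (hX' : X'.IsBundleOn univ) {T : Type*} [TopologicalSpace T] {b : T → B} (hb : Continuous b)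
    {V₁ : V.Ob} {V₁' : V'.Ob} {k : ∀ t, V₁ ⟶ fib (b t)} {k' : ∀ t, V₁' ⟶ fib' (b t)}
    (hk : ∀ v, Continuous fun t => X.emb (b t) (toLin (k t) v))
    (hk' : ∀ v, Continuous fun t => X'.emb (b t) (toLin (k' t) v))
    {w : T → ψ.obj (V₁, V₁')} (hw : Continuous w) :
    Continuous fun t => (⟨b t, toLin (bimap ψ (k t) (k' t)) (w t)⟩ : BiTotal ψ X X') := by
  refine continuous_iff_continuousAt.2 fun t₀ => ?_
  obtain ⟨N, hN, hbN, -, V₀, e, V₀', e', he, he'⟩ := hX.exists_triv hX' (b := b t₀) univ_mem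
  have hP : IsOpen (b ⁻¹' N) := hN.preimage hb
  refine ContinuousOn.continuousAt (s := b ⁻¹' N) ?_ (hP.mem_nhds hbN)
  rw [continuousOn_iff_continuous_domRestrict]
  let s : b ⁻¹' N → N := fun p => ⟨b p.1, p.2⟩
  have h1 := he.continuous_coord (s := s) (k := fun p : b ⁻¹' N => k p.1) fun v =>
      (hk v).comp continuous_subtype_val
  have h2 := he'.continuous_coord (s := s) (k := fun p : b ⁻¹' N => k' p.1) fun v =>
      (hk' v).comp continuous_subtype_val
  have h3 := hψ.continuous_bimap h1 h2 (hw.comp continuous_subtype_val)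
  have hs : Continuous s := by fun_prop
  refine ((isOpenEmbedding_biTriv_of_isOpen hψ hN he he').continuous.comp
    (hs.prodMk h3)).congr fun p => ?_
  exact congrArg (BiTotal.mk (b p.1))
      (bimap_hom_inv ψ (k p.1) (k' p.1) (e (s p)) (e' (s p)) (w p.1))

/-- `IsInducedOn` speaks of trivializations over arbitrary subsets, which need not extend to open
ones, so the open charts are not enough. Convergence in the total space is first read in an open
chart `e₁`, `e₁'` near the limit; the continuous transition back to `e`, `e'`, defined over the
preimage of its domain, then gives convergence of the original coordinates. -/
theorem isEmbedding_biTriv (hψ : IsContinuousBifunctor ψ) (hX : X.IsBundleOn univ)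
    (hX' : X'.IsBundleOn univ) {T : Type u} [TopologicalSpace T] {g : T → B} (hg : IsEmbedding g)
    {V₀ : V.Ob} {V₀' : V'.Ob} {e : ∀ t, V₀ ≅ fib (g t)} {e' : ∀ t, V₀' ≅ fib' (g t)}
    (he : X.Triv g V₀ e) (he' : X'.Triv g V₀' e') :
    IsEmbedding (biTriv ψ X X' g e e') := by
  have hcont : Continuous (biTriv ψ X X' g e e') :=
    BiTotal.continuous_mk hψ hX hX' (hg.continuous.comp continuous_fst)
      (k := fun q : T × ψ.obj (V₀, V₀') => (e q.1).hom) (k' := fun q => (e' q.1).hom)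
      (fun v => he.continuous.comp (continuous_fst.prodMk continuous_const))
      (fun v => he'.continuous.comp (continuous_fst.prodMk continuous_const)) continuous_snd
  refine ⟨isInducing_iff_nhds.2 fun q₀ => le_antisymm (hcont.tendsto q₀).le_comap ?_,
    biTriv_injective hg.injective e e'⟩
  obtain ⟨N, hN, hbN, -, V₁, e₁, V₁', e₁', he₁, he₁'⟩ :=
    hX.exists_triv hX' (b := g q₀.1) univ_mem
  let P : Set (T × ψ.obj (V₀, V₀')) := {q | g q.1 ∈ N}
  let l := comap (biTriv ψ X X' g e e') (𝓝 (biTriv ψ X X' g e e' q₀))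
  have hτl : Tendsto (biTriv ψ X X' g e e') l (𝓝 (biTriv ψ X X' g e e' q₀)) := tendsto_comap
  have hPl : P ∈ l :=
    hτl ((hN.preimage BiTotal.continuous_base).mem_nhds hbN)
  let p₀ : P := ⟨q₀, hbN⟩
  -- The coordinates of the open chart exist only over `N`, so the filter is restricted to `P`,
  -- which belongs to it.
  let l' : Filter P := comap Subtype.val l
  have hl' : map Subtype.val l' = l := map_comap_of_mem (by simpa using hPl)
  suffices Tendsto (fun p : P => p.1) l' (𝓝 q₀) by
    change l ≤ _
    rw [← hl']
    exact this
  have hτ : Tendsto (fun p : P => biTriv ψ X X' g e e' p.1) l' (𝓝 (biTriv ψ X X' g e e' q₀)) :=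
    hτl.comp tendsto_comap
  have ht : Tendsto (fun p : P => p.1.1) l' (𝓝 q₀.1) :=
    (hg.isInducing.tendsto_nhds_iff).2 ((BiTotal.continuous_base.tendsto _).comp hτ)
  let s : {t // g t ∈ N} → N := fun t => ⟨g t.1, t.2⟩
  let a : P → {t // g t ∈ N} := fun p => ⟨p.1.1, p.2⟩
  have ha : Tendsto a l' (𝓝 (a p₀)) := tendsto_subtype_rng.2 ht
  have hs : Continuous s := (hg.continuous.comp continuous_subtype_val).subtype_mk _
  let r : P → ψ.obj (V₁, V₁') := fun p => toLin (bimap ψ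
    ((e p.1.1).hom ≫ (e₁ (s (a p))).inv) ((e' p.1.1).hom ≫ (e₁' (s (a p))).inv)) p.1.2
  have hρτ : ∀ p : P, biTriv ψ X X' Subtype.val e₁ e₁' (s (a p), r p) =
      biTriv ψ X X' g e e' p.1 := fun p =>
    congrArg (BiTotal.mk (g p.1.1))
      (bimap_hom_inv ψ (e p.1.1).hom (e' p.1.1).hom (e₁ (s (a p))) (e₁' (s (a p))) p.1.2)
  have hr : Tendsto r l' (𝓝 (r p₀)) := by
    have h := (isOpenEmbedding_biTriv_of_isOpen hψ hN he₁ he₁').isInducing.tendsto_nhds_iff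
      (f := fun p => (s (a p), r p)) (y := (s (a p₀), r p₀)) (l := l') |>.2 (by
        simpa only [Function.comp_def, hρτ] using hτ)
    exact h.snd_nhds
  have hk : Continuous fun t : {t // g t ∈ N} => (e₁ (s t)).hom ≫ (e t.1).inv :=
    he.continuous_coord (s := fun t : {t // g t ∈ N} => t.1) (k := fun t => (e₁ (s t)).hom)
      fun v => he₁.continuous.comp (hs.prodMk continuous_const)
  have hk' : Continuous fun t : {t // g t ∈ N} => (e₁' (s t)).hom ≫ (e' t.1).inv :=
    he'.continuous_coord (s := fun t : {t // g t ∈ N} => t.1) (k := fun t => (e₁' (s t)).hom)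
      fun v => he₁'.continuous.comp (hs.prodMk continuous_const)
  have hw := ((hψ.continuous_bimap (hk.comp continuous_fst) (hk'.comp continuous_fst)
    continuous_snd).tendsto (a p₀, r p₀)).comp (ha.prodMk_nhds hr)
  have hinv : ∀ p : P, toLin (bimap ψ ((e₁ (s (a p))).hom ≫ (e p.1.1).inv)
      ((e₁' (s (a p))).hom ≫ (e' p.1.1).inv)) (r p) = p.1.2 := by
    intro p
    rw [← LinearMap.comp_apply, ← toLin_comp, ← bimap_comp]
    simp [s, a]
  refine ht.prodMk_nhds ?_
  have := hw.congr hinv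
  have h0 := hinv p₀
  dsimp only [p₀] at h0
  rw [← h0]
  exact this

theorem BiTotal.isEmbedding_mk (hψ : IsContinuousBifunctor ψ) (hX : X.IsBundleOn univ)
    (hX' : X'.IsBundleOn univ) (b : B) :
    IsEmbedding (fun v => ⟨b, v⟩ : ψ.obj (fib b, fib' b) → BiTotal ψ X X') := by
  obtain ⟨N, hN, hb, -, V₀, e, V₀', e', he, he'⟩ := hX.exists_triv hX' (b := b) univ_mem
  have := ((isOpenEmbedding_biTriv_of_isOpen hψ hN he he').isEmbedding.comp
    (isEmbedding_prodMkRight (⟨b, hb⟩ : N))).comp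
      (homeomorphOfIso (bimapIso ψ (e ⟨b, hb⟩) (e' ⟨b, hb⟩))).symm.isEmbedding
  convert this using 2 with v
  exact congrArg (BiTotal.mk (b))
    ((homeomorphOfIso (bimapIso ψ (e ⟨b, hb⟩) (e' ⟨b, hb⟩))).apply_symm_apply v).symm

/-- The bundle with fibers `ψ(X_b, X'_b)`. -/
noncomputable def biBundle (hψ : IsContinuousBifunctor ψ) (hX : X.IsBundleOn univ)
    (hX' : X'.IsBundleOn univ) : VFamily W B fun b => ψ.obj (fib b, fib' b) :=
  VFamily.ofFibers (BiTotal ψ X X') BiTotal.base BiTotal.continuous_base BiTotal.mk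
    (BiTotal.isEmbedding_mk hψ hX hX') fun b => by
      ext ⟨b', v⟩
      constructor
      · rintro ⟨w, hw⟩
        exact congrArg BiTotal.base hw.symm
      · rintro rfl
        exact ⟨v, rfl⟩

theorem biBundle_triv (hψ : IsContinuousBifunctor ψ) (hX : X.IsBundleOn univ)
    (hX' : X'.IsBundleOn univ) {T : Type u} [TopologicalSpace T] {g : T → B} (hg : IsEmbedding g)
    {V₀ : V.Ob} {V₀' : V'.Ob} {e : ∀ t, V₀ ≅ fib (g t)} {e' : ∀ t, V₀' ≅ fib' (g t)}
    (he : X.Triv g V₀ e) (he' : X'.Triv g V₀' e') :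
    (biBundle hψ hX hX').Triv g (ψ.obj (V₀, V₀')) fun t => bimapIso ψ (e t) (e' t) :=
  isEmbedding_biTriv hψ hX hX' hg he he'

theorem biBundle_isInducedOn (hψ : IsContinuousBifunctor ψ) (hX : X.IsBundleOn univ)
    (hX' : X'.IsBundleOn univ) : IsInducedOn ψ X X' (biBundle hψ hX hX') univ :=
  fun _ _ _ _ _ _ he he' => biBundle_triv hψ hX hX' IsEmbedding.subtypeVal he he'

theorem IsInducedOn.isBundleOn {E : VFamily W B fun b => ψ.obj (fib b, fib' b)} {C : Set B}
    (h : IsInducedOn ψ X X' E C) (hX : X.IsBundleOn C) (hX' : X'.IsBundleOn C) :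
    E.IsBundleOn C := by
  intro b hb
  obtain ⟨U, hU, hUC, V₀, e, he⟩ := hX b hb
  obtain ⟨U', hU', hUC', V₀', e', he'⟩ := hX' b hb
  have he₁ : X.Triv (Subtype.val : U → B) V₀ e := he
  have he₁' : X'.Triv (Subtype.val : U' → B) V₀' e' := he'
  exact ⟨U ∩ U', inter_mem hU hU', fun x hx => hUC hx.1, _, _, h (U ∩ U') V₀ V₀'
    (fun c => e ⟨c.1, c.2.1⟩) (fun c => e' ⟨c.1, c.2.2⟩) (fun x hx => hUC hx.1)
    (he₁.comp (IsEmbedding.inclusion inter_subset_left))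
    (he₁'.comp (IsEmbedding.inclusion inter_subset_right))⟩

end Bifamily

end StratBdl

namespace StratBdl

open Filter Set

/-! ### Bifunctors applied to maps of families -/

section Bimap

variable {V V' W : StructureCategory.{u}} {ψ : V.Ob × V'.Ob ⥤ W.Ob}
  {S : Type u} [TopologicalSpace S] {F : S → V.Ob} {F' : S → V'.Ob}
  {X : VFamily V S F} {X' : VFamily V' S F'}
  {N : Type u} [TopologicalSpace N] {G : N → V.Ob} {G' : N → V'.Ob}
  {Y : VFamily V N G} {Y' : VFamily V' N G'}
  {M : Type u} [TopologicalSpace M] {H : M → V.Ob} {H' : M → V'.Ob}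
  {Z : VFamily V M H} {Z' : VFamily V' M H'}

variable (ψ) in
/-- The fiberwise image of a pair of maps of families. -/
def biMap {χ : C(N, S)} (f : VMap χ Y X) (f' : VMap χ Y' X') (x : BiTotal ψ Y Y') :
    BiTotal ψ X X' :=
  ⟨χ x.base, toLin (bimap ψ (f.fiberMap x.base) (f'.fiberMap x.base)) x.vec⟩

/-- The morphisms are compared inside the total spaces, where no transport along `s = s'` is needed;
the vector `0` already yields that equality. -/
theorem BiTotal.mk_eq_mk_of_emb {s s' : S} {a : V.Ob} {a' : V'.Ob} {p : a ⟶ F s} {q : a ⟶ F s'}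
    {p' : a' ⟶ F' s} {q' : a' ⟶ F' s'} (h : ∀ v, X.emb s (toLin p v) = X.emb s' (toLin q v))
    (h' : ∀ v, X'.emb s (toLin p' v) = X'.emb s' (toLin q' v)) (w : ψ.obj (a, a')) :
    (⟨s, toLin (bimap ψ p p') w⟩ : BiTotal ψ X X') = ⟨s', toLin (bimap ψ q q') w⟩ := by
  obtain rfl : s = s' := by simpa using congrArg X.proj (h 0)
  rw [hom_ext fun v => (X.isEmbedding_emb s).injective (h v),
    hom_ext fun v => (X'.isEmbedding_emb s).injective (h' v)]

theorem exists_lift_of_isIso {s s' : S} (hs : s = s') {a c : V.Ob} (p : a ⟶ F s) (q : c ⟶ F s')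
    [IsIso q] : ∃ k : a ⟶ c, ∀ v, X.emb s (toLin p v) = X.emb s' (toLin (k ≫ q) v) := by
  subst hs
  exact ⟨p ≫ inv q, fun v => by simp only [Category.assoc, IsIso.inv_hom_id, Category.comp_id]⟩

theorem isIso_bimap {a b : V.Ob} {a' b' : V'.Ob} (f : a ⟶ b) (f' : a' ⟶ b') [IsIso f]
    [IsIso f'] : IsIso (bimap ψ f f') :=
  (bimapIso ψ (asIso f) (asIso f')).isIso_hom

theorem toLin_injective_of_isIso {a b : W.Ob} (f : a ⟶ b) [IsIso f] :
    Function.Injective (toLin f) :=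
  (homeomorphOfIso (asIso f)).injective

/-- The convergence theorem behind the continuity of `ψ` on attaching maps: limits of fiber maps
may only belong to the closure of the structure category. -/
theorem exists_subseq_tendsto_bimap [T2Space M] (hψ : IsContinuousBifunctor ψ)
    (Ψ : ClosureExtension ψ) {ξ : C(M, S)} (g : VMap ξ Z X) (g' : VMap ξ Z' X')
    (hZ : Z.IsBundleOn univ) (hZ' : Z'.IsBundleOn univ) {A : Set M}
    (hl : LiftsSequences (Z.proj ⁻¹' A) g.toFun) (hl' : LiftsSequences (Z'.proj ⁻¹' A) g'.toFun)
    {a : V.Ob} {a' : V'.Ob} {m : ℕ → M} (hm : ∀ n, m n ∉ A) (k : ∀ n, a ⟶ H (m n))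
    (k' : ∀ n, a' ⟶ H' (m n)) {s : S} (p : a ⟶ F s) (p' : a' ⟶ F' s)
    (hk : ∀ v, Tendsto (fun n => g.toFun (Z.emb (m n) (toLin (k n) v))) atTop
      (𝓝 (X.emb s (toLin p v))))
    (hk' : ∀ v, Tendsto (fun n => g'.toFun (Z'.emb (m n) (toLin (k' n) v))) atTop
      (𝓝 (X'.emb s (toLin p' v))))
    {w : ℕ → ψ.obj (a, a')} {w₀ : ψ.obj (a, a')} (hw : Tendsto w atTop (𝓝 w₀)) :
    ∃ r : ℕ → ℕ, StrictMono r ∧ ∃ y : BiTotal ψ Z Z',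
      Tendsto (fun n => (⟨m (r n), toLin (bimap ψ (k (r n)) (k' (r n))) (w (r n))⟩ :
        BiTotal ψ Z Z')) atTop (𝓝 y) ∧
      biMap ψ g g' y = ⟨s, toLin (bimap ψ p p') w₀⟩ := by
  let β := Module.Free.chooseBasis ℝ a
  let β' := Module.Free.chooseBasis ℝ a'
  -- The subsequence provided by lifting depends on the vector, so only finitely many vectors are
  -- used: a basis, and the zero vector (index `none`). The latter follows the base points and works
  -- also when the fiber is zero.
  let vec : Option (Module.Free.ChooseBasisIndex ℝ a) → a := fun o => o.elim 0 β
  let vec' : Option (Module.Free.ChooseBasisIndex ℝ a') → a' := fun o => o.elim 0 β'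
  let Q : Option (Module.Free.ChooseBasisIndex ℝ a) ⊕ Option (Module.Free.ChooseBasisIndex ℝ a') →
      (ℕ → ℕ) → Prop := fun o r => Sum.elim
    (fun o => ∃ y, Tendsto (fun n => Z.emb (m (r n)) (toLin (k (r n)) (vec o))) atTop (𝓝 y) ∧
      g.toFun y = X.emb s (toLin p (vec o)))
    (fun o => ∃ y, Tendsto (fun n => Z'.emb (m (r n)) (toLin (k' (r n)) (vec' o))) atTop (𝓝 y) ∧
      g'.toFun y = X'.emb s (toLin p' (vec' o))) o
  obtain ⟨r, hr, hQ⟩ := exists_common_subseq (P := Q) (by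
    rintro (o | o) r l ⟨y, hy, hgy⟩ hl
    · exact ⟨y, hy.comp hl.tendsto_atTop, hgy⟩
    · exact ⟨y, hy.comp hl.tendsto_atTop, hgy⟩) (by
    rintro (o | o) r hr
    · exact hl _ _ (fun n => by simpa using hm (r n)) ((hk (vec o)).comp hr.tendsto_atTop)
    · exact hl' _ _ (fun n => by simpa using hm (r n)) ((hk' (vec' o)).comp hr.tendsto_atTop))
  choose y hy hgy using fun o => hQ (Sum.inl o)
  choose y' hy' hgy' using fun o => hQ (Sum.inr o)
  let m₀ := Z.proj (y none)
  have hmr : Tendsto (fun n => m (r n)) atTop (𝓝 m₀) := by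
    simpa [Function.comp_def] using (Z.continuous_proj.tendsto _).comp (hy none)
  -- All limits lie over the same point because `M` is Hausdorff.
  have hbase : ∀ o, ∃ v, Z.emb m₀ v = y o := fun o => by
    have : Tendsto (fun n => m (r n)) atTop (𝓝 (Z.proj (y o))) := by
      simpa [Function.comp_def] using (Z.continuous_proj.tendsto _).comp (hy o)
    rw [tendsto_nhds_unique hmr this]
    exact Z.exists_emb_eq _
  have hbase' : ∀ o, ∃ v, Z'.emb m₀ v = y' o := fun o => by
    have : Tendsto (fun n => m (r n)) atTop (𝓝 (Z'.proj (y' o))) := by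
      simpa [Function.comp_def] using (Z'.continuous_proj.tendsto _).comp (hy' o)
    rw [tendsto_nhds_unique hmr this]
    exact Z'.exists_emb_eq _
  choose t ht using hbase
  choose t' ht' using hbase'
  obtain ⟨U, hU, hm₀, -, b, e, b', e', he, he'⟩ := hZ.exists_triv hZ' (b := m₀) univ_mem
  obtain ⟨L, hL⟩ := eventually_atTop.1 (hmr.eventually (hU.mem_nhds hm₀))
  let r' : ℕ → ℕ := fun n => r (n + L)
  have hr' : StrictMono r' := fun i j h => hr (Nat.add_lt_add_right h L)
  let c : ℕ → U := fun n => ⟨m (r' n), hL _ (Nat.le_add_left _ _)⟩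
  let c₀ : U := ⟨m₀, hm₀⟩
  have hc := fun o => he.tendsto_coord (s := c) (s₀ := c₀)
    (u := fun n => toLin (k (r' n)) (vec o)) (u₀ := t o)
    (by rw [ht]; exact (tendsto_add_atTop_iff_nat L).2 (hy o))
  have hc' := fun o => he'.tendsto_coord (s := c) (s₀ := c₀)
    (u := fun n => toLin (k' (r' n)) (vec' o)) (u₀ := t' o)
    (by rw [ht']; exact (tendsto_add_atTop_iff_nat L).2 (hy' o))
  let φ : ℕ → (a ⟶ b) := fun n => k (r' n) ≫ (e (c n)).inv
  let φ' : ℕ → (a' ⟶ b') := fun n => k' (r' n) ≫ (e' (c n)).inv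
  let φ₀ : a →ₗ[ℝ] b := β.constr ℝ fun i => toLin (e c₀).inv (t (some i))
  let φ₀' : a' →ₗ[ℝ] b' := β'.constr ℝ fun i => toLin (e' c₀).inv (t' (some i))
  have hφ₀ : ∀ i, φ₀ (β i) = toLin (e c₀).inv (t (some i)) := fun i => β.constr_basis ℝ _ i
  have hφ₀' : ∀ i, φ₀' (β' i) = toLin (e' c₀).inv (t' (some i)) := fun i => β'.constr_basis ℝ _ i
  have hβφ : ∀ i, Tendsto (fun n => toLin (φ n) (β i)) atTop (𝓝 (φ₀ (β i))) := fun i => by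
    rw [hφ₀]
    exact (hc (some i)).2
  have hβφ' : ∀ i, Tendsto (fun n => toLin (φ' n) (β' i)) atTop (𝓝 (φ₀' (β' i))) := fun i => by
    rw [hφ₀']
    exact (hc' (some i)).2
  -- As a limit of the morphisms `φ n`, the map `φ₀` belongs to the closure of the category, though
  -- in general not to the category itself.
  let Φ : V.incl.obj a ⟶ V.incl.obj b := ⟨φ₀,
    @mem_closure_of_tendsto _ (linTop a.carrier b.carrier) _ _ _ _ _ _
      (tendsto_lin_of_basis β hβφ) (Eventually.of_forall fun n => (φ n).2)⟩
  let Φ' : V'.incl.obj a' ⟶ V'.incl.obj b' := ⟨φ₀',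
    @mem_closure_of_tendsto _ (linTop a'.carrier b'.carrier) _ _ _ _ _ _
      (tendsto_lin_of_basis β' hβφ') (Eventually.of_forall fun n => (φ' n).2)⟩
  have hΦ : Tendsto (fun n => V.incl.map (φ n)) atTop (𝓝 Φ) :=
    tendsto_hom_of_basis (X := V.incl.obj a) β hβφ
  have hΦ' : Tendsto (fun n => V'.incl.map (φ' n)) atTop (𝓝 Φ') :=
    tendsto_hom_of_basis (X := V'.incl.obj a') β' hβφ'
  -- The limit vector exists only through the extension of ψ to the closures.
  let w₁ : ψ.obj (b, b') := toLin (Ψ.map Φ Φ') w₀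
  have hw₁ : Tendsto (fun n => toLin (bimap ψ (φ n) (φ' n)) (w (r' n))) atTop (𝓝 w₁) := by
    have h1 := (Ψ.continuous_map.tendsto (Φ, Φ')).comp (hΦ.prodMk_nhds hΦ')
    have h2 := ((continuous_eval _ _).tendsto (Ψ.map Φ Φ', w₀)).comp
      (h1.prodMk_nhds (hw.comp hr'.tendsto_atTop))
    refine h2.congr fun n => ?_
    change toLin (Ψ.map (V.incl.map (φ n)) (V'.incl.map (φ' n))) _ = _
    rw [Ψ.map_incl]
    rfl
  refine ⟨r', hr', biTriv ψ Z Z' Subtype.val e e' (c₀, w₁), ?_, ?_⟩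
  · refine (((isOpenEmbedding_biTriv_of_isOpen hψ hU he he').continuous.tendsto _).comp
      ((hc none).1.prodMk_nhds hw₁)).congr fun n => ?_
    exact congrArg (BiTotal.mk (m (r' n)))
      (bimap_hom_inv ψ (k (r' n)) (k' (r' n)) (e (c n)) (e' (c n)) (w (r' n)))
  · have hgt : ∀ o, X.emb (ξ m₀) (toLin (g.fiberMap m₀) (t o)) = X.emb s (toLin p (vec o)) :=
      fun o => by rw [← g.map_emb, ht, hgy]
    have hgt' : ∀ o, X'.emb (ξ m₀) (toLin (g'.fiberMap m₀) (t' o)) =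
        X'.emb s (toLin p' (vec' o)) := fun o => by rw [← g'.map_emb, ht', hgy']
    obtain rfl : ξ m₀ = s := by simpa using congrArg X.proj (hgt none)
    -- A factorization that exists only in the closure: it is checked on the basis, where it
    -- expresses that the lifted limits map to the given ones.
    have hp : V.incl.map p = Φ ≫ V.incl.map ((e c₀).hom ≫ g.fiberMap m₀) := by
      refine Subtype.ext (β.ext fun i => ?_)
      change toLin p (β i) = toLin (g.fiberMap m₀) (toLin (e c₀).hom (φ₀ (β i)))
      rw [hφ₀, toLin_hom_inv]
      exact ((X.isEmbedding_emb _).injective (hgt (some i))).symm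
    have hp' : V'.incl.map p' = Φ' ≫ V'.incl.map ((e' c₀).hom ≫ g'.fiberMap m₀) := by
      refine Subtype.ext (β'.ext fun i => ?_)
      change toLin p' (β' i) = toLin (g'.fiberMap m₀) (toLin (e' c₀).hom (φ₀' (β' i)))
      rw [hφ₀', toLin_hom_inv]
      exact ((X'.isEmbedding_emb _).injective (hgt' (some i))).symm
    refine congrArg (BiTotal.mk (ξ m₀)) ?_
    -- Applying `Ψ` to both factorizations shows that `g`, `g'` carry the constructed limit to ψ(p,
    -- p')(w₀).
    have h := Ψ.map_incl p p'
    rw [hp, hp', Ψ.map_comp, Ψ.map_incl, bimap_comp] at h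
    exact LinearMap.congr_fun (congrArg toLin h) w₀

/-- Convergent sequences in the bundle `ψ(Y, Y')` whose images in `ψ(X, X')` are images of points
of `ψ(Z, Z')` lift, after passage to a subsequence, to convergent sequences in `ψ(Z, Z')`. -/
theorem exists_subseq_tendsto_of_biMap_eq [T2Space M] (hψ : IsContinuousBifunctor ψ)
    (Ψ : ClosureExtension ψ) {χ : C(N, S)} {ξ : C(M, S)} (f : VMap χ Y X) (f' : VMap χ Y' X')
    (g : VMap ξ Z X) (g' : VMap ξ Z' X') (hY : Y.IsBundleOn univ) (hY' : Y'.IsBundleOn univ)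
    (hZ : Z.IsBundleOn univ) (hZ' : Z'.IsBundleOn univ) {A : Set M}
    (hl : LiftsSequences (Z.proj ⁻¹' A) g.toFun) (hl' : LiftsSequences (Z'.proj ⁻¹' A) g'.toFun)
    (hg : ∀ m ∉ A, IsIso (g.fiberMap m)) (hg' : ∀ m ∉ A, IsIso (g'.fiberMap m))
    {x : ℕ → BiTotal ψ Y Y'} {x₀ : BiTotal ψ Y Y'} (hx : Tendsto x atTop (𝓝 x₀))
    {z : ℕ → BiTotal ψ Z Z'} (hz : ∀ n, (z n).base ∉ A)
    (hxz : ∀ n, biMap ψ f f' (x n) = biMap ψ g g' (z n)) :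
    ∃ r : ℕ → ℕ, ∃ y, Tendsto (fun n => z (r n)) atTop (𝓝 y) ∧
      biMap ψ g g' y = biMap ψ f f' x₀ := by
  obtain ⟨U, hU, hx₀, -, a, e, a', e', he, he'⟩ := hY.exists_triv hY' (b := x₀.base) univ_mem
  let q₀ : U × ψ.obj (a, a') := (⟨x₀.base, hx₀⟩,
    toLin (bimapIso ψ (e ⟨x₀.base, hx₀⟩) (e' ⟨x₀.base, hx₀⟩)).inv x₀.vec)
  have hq₀ : biTriv ψ Y Y' Subtype.val e e' q₀ = x₀ :=
    congrArg (BiTotal.mk x₀.base) (toLin_hom_inv (bimapIso ψ (e ⟨x₀.base, hx₀⟩)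
      (e' ⟨x₀.base, hx₀⟩)) x₀.vec)
  obtain ⟨L, q, hq, hqx⟩ := exists_lift_tendsto_of_isOpenEmbedding
    (isOpenEmbedding_biTriv_of_isOpen hψ hU he he') (y := q₀) (x := x) (by rwa [hq₀])
  let m : ℕ → M := fun n => (z (n + L)).base
  have hm : ∀ n, m n ∉ A := fun n => hz _
  have hbm : ∀ n, χ (q n).1 = ξ (m n) := fun n => by
    have := hxz (n + L)
    rw [← hqx] at this
    exact congrArg BiTotal.base this
  -- Outside `A` the fiber maps of `g` are invertible in `V`, so the fiber maps of `f`, read in the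
  -- trivialization, factor through them by morphisms of `V`.
  have hlift : ∀ n, ∃ k : a ⟶ H (m n), ∀ v,
      X.emb (χ (q n).1) (toLin ((e (q n).1).hom ≫ f.fiberMap (q n).1) v) =
        X.emb (ξ (m n)) (toLin (k ≫ g.fiberMap (m n)) v) := fun n =>
    have := hg _ (hm n)
    exists_lift_of_isIso (hbm n) _ _
  have hlift' : ∀ n, ∃ k : a' ⟶ H' (m n), ∀ v,
      X'.emb (χ (q n).1) (toLin ((e' (q n).1).hom ≫ f'.fiberMap (q n).1) v) =
        X'.emb (ξ (m n)) (toLin (k ≫ g'.fiberMap (m n)) v) := fun n =>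
    have := hg' _ (hm n)
    exists_lift_of_isIso (hbm n) _ _
  choose k hk using hlift
  choose k' hk' using hlift'
  -- Injectivity of ψ(g, g') on the fibers outside `A` identifies the given `z` with the image of
  -- the coordinate vector under the lifted morphisms.
  have hzq : ∀ n, z (n + L) = ⟨m n, toLin (bimap ψ (k n) (k' n)) (q n).2⟩ := by
    intro n
    have h1 := BiTotal.mk_eq_mk_of_emb (ψ := ψ) (hk n) (hk' n) (q n).2
    have h2 := hxz (n + L)
    rw [← hqx] at h2
    have := hg _ (hm n)
    have := hg' _ (hm n)
    have := isIso_bimap (ψ := ψ) (g.fiberMap (m n)) (g'.fiberMap (m n))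
    refine congrArg (BiTotal.mk (m n))
      (toLin_injective_of_isIso (bimap ψ (g.fiberMap (m n)) (g'.fiberMap (m n))) ?_)
    rw [bimap_comp, bimap_comp] at h1
    exact eq_of_heq (BiTotal.mk.inj (h2.symm.trans h1)).2
  obtain ⟨r, -, y, hy, hgy⟩ := exists_subseq_tendsto_bimap hψ Ψ g g' hZ hZ' hl hl' hm k k'
    ((e q₀.1).hom ≫ f.fiberMap q₀.1) ((e' q₀.1).hom ≫ f'.fiberMap q₀.1)
    (fun v => by
      have h := (f.toFun.continuous.tendsto _).comp
        ((he.continuous.tendsto (q₀.1, v)).comp (hq.fst_nhds.prodMk_nhds tendsto_const_nhds))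
      simp only [Function.comp_def, f.map_emb] at h
      refine h.congr fun n => ?_
      rw [g.map_emb]
      exact hk n v)
    (fun v => by
      have h := (f'.toFun.continuous.tendsto _).comp
        ((he'.continuous.tendsto (q₀.1, v)).comp (hq.fst_nhds.prodMk_nhds tendsto_const_nhds))
      simp only [Function.comp_def, f'.map_emb] at h
      refine h.congr fun n => ?_
      rw [g'.map_emb]
      exact hk' n v) hq.snd_nhds
  refine ⟨fun n => r n + L, y, hy.congr fun n => (hzq (r n)).symm, ?_⟩
  rw [hgy, bimap_comp]
  exact congrArg (biMap ψ f f') hq₀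

end Bimap

end StratBdl

namespace StratBdl

open Filter Set

/-! ### Closedness in stratified spaces and stratified bundles -/

section Strat

instance (S : StratSpace.{u}) (i : ℕ) : T2Space (S.M i) := (S.isCWPair i).1

instance (S : StratSpace.{u}) (i : ℕ) : SequentialSpace (S.M i) :=
  (S.isCWPair i).isCWSpace.sequentialSpace

instance (S : StratSpace.{u}) : T2Space (S.filt 0) := S.isCWSpace_zero.1

instance (S : StratSpace.{u}) : SequentialSpace (S.filt 0) := S.isCWSpace_zero.sequentialSpace

/-! ### The filtration of a stratified space -/

namespace StratSpace

theorem filt_mono (S : StratSpace.{u}) : Monotone S.filt :=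
  monotone_nat_of_le_succ fun i => (S.isAttached i).subset

theorem char_mem (S : StratSpace.{u}) (i : ℕ) (m : S.M i) : S.char i m ∈ S.filt (i + 1) :=
  (S.isAttached i).mapsTo_univ m

theorem char_mem_iff (S : StratSpace.{u}) (i : ℕ) (m : S.M i) :
    S.char i m ∈ S.filt i ↔ m ∈ S.A i :=
  ⟨fun h => by_contra fun hm => ((S.isAttached i).bijOn.mapsTo hm).2 h,
    fun h => (S.isAttached i).mapsTo h⟩

/-- Each `filt n` is closed in `filt (n + 1)`, since its preimage in `M n` is the subcomplex `A n`.
Transitivity of closedness and the colimit topology do the rest. -/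
theorem isClosed_filt (S : StratSpace.{u}) (i : ℕ) : IsClosed (S.filt i) := by
  have hstep : ∀ n, IsClosed ((↑) ⁻¹' S.filt n : Set (S.filt (n + 1))) := fun n => by
    rw [(S.isAttached n).isClosed_iff _ (S.isAttached n).subset]
    constructor
    · convert (S.isCWPair n).isClosed using 1
      ext m
      exact S.char_mem_iff n m
    · convert isClosed_univ
      exact eq_univ_of_forall fun x => x.2
  refine S.isColimit.isClosed_of _ fun n => ?_
  rcases le_total n i with h | h
  · convert isClosed_univ
    exact eq_univ_of_forall fun x => S.filt_mono h x.2
  · induction n, h using Nat.le_induction with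
    | base =>
      convert isClosed_univ
      exact eq_univ_of_forall fun x => x.2
    | succ n hn ih =>
      obtain ⟨T, hT, hTi⟩ := isClosed_induced_iff.1 ih
      obtain ⟨T', hT', hTn⟩ := isClosed_induced_iff.1 (hstep n)
      refine isClosed_induced_iff.2 ⟨T ∩ T', hT.inter hT', ?_⟩
      ext x
      constructor
      · intro hx
        have hxn : x.1 ∈ S.filt n := (Set.ext_iff.1 hTn x).1 hx.2
        exact (Set.ext_iff.1 hTi ⟨x, hxn⟩).1 hx.1
      · intro hx
        have hxn : x.1 ∈ S.filt n := S.filt_mono hn hx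
        exact ⟨(Set.ext_iff.1 hTi ⟨x, hxn⟩).2 hx, (Set.ext_iff.1 hTn x).2 hxn⟩

end StratSpace

/-! ### Maps of families and their restrictions -/

section VMaps

variable {V : StructureCategory.{u}} {B B' : Type u} [TopologicalSpace B] [TopologicalSpace B']
  {fib : B → V.Ob} {fib' : B' → V.Ob}

theorem VMap.ext {φ : C(B, B')} {X : VFamily V B fib} {Y : VFamily V B' fib'}
    {f g : VMap φ X Y} (h : ∀ b, f.fiberMap b = g.fiberMap b) : f = g := by
  obtain ⟨t, k, hk⟩ := f
  obtain ⟨t', k', hk'⟩ := g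
  obtain rfl : k = k' := funext h
  obtain rfl : t = t' := ContinuousMap.ext fun x => by
    obtain ⟨v, hv⟩ := X.exists_emb_eq x
    rw [← hv, hk, hk']
  rfl

theorem VMap.proj_toFun {φ : C(B, B')} {X : VFamily V B fib} {Y : VFamily V B' fib'}
    (f : VMap φ X Y) (x : X.Total) : Y.proj (f.toFun x) = φ (X.proj x) := by
  obtain ⟨v, hv⟩ := X.exists_emb_eq x
  nth_rw 1 [← hv]
  rw [f.map_emb, Y.proj_emb]

theorem VMap.mapsTo_preimage {φ : C(B, B')} {X : VFamily V B fib} {Y : VFamily V B' fib'}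
    (f : VMap φ X Y) {C : Set B} {D : Set B'} (h : MapsTo φ C D) :
    MapsTo f.toFun (X.proj ⁻¹' C) (Y.proj ⁻¹' D) := fun x hx => by
  rw [mem_preimage, f.proj_toFun]
  exact h hx

/-- The inclusion of the restriction of a family. -/
def VFamily.restrictIncl (X : VFamily V B fib) (C : Set B) :
    VMap (⟨Subtype.val, continuous_subtype_val⟩ : C(C, B)) (X.restrict C) X where
  toFun := ⟨Subtype.val, continuous_subtype_val⟩
  fiberMap b := 𝟙 (fib b)
  map_emb _ _ := rfl

/-- The restriction of a map of families. -/
def VMap.restrict {φ : C(B, B')} {X : VFamily V B fib} {Y : VFamily V B' fib'} (f : VMap φ X Y)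
    {C : Set B} {D : Set B'} (h : MapsTo φ C D) :
    VMap (⟨h.restrict, φ.continuous.restrict h⟩ : C(C, D)) (X.restrict C) (Y.restrict D) where
  toFun := ⟨(f.mapsTo_preimage h).restrict, f.toFun.continuous.restrict (f.mapsTo_preimage h)⟩
  fiberMap b := f.fiberMap b
  map_emb b v := Subtype.ext (f.map_emb b v)

end VMaps

/-! ### Separation and lifting of sequences in stratified bundles -/

namespace StratBundle

variable {V : StructureCategory.{u}} {S : StratSpace.{u}} {F : Fibers V S}

theorem isClosed_proj_filt (X : StratBundle V S F) (i : ℕ) :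
    IsClosed (X.fam.proj ⁻¹' S.filt i) :=
  (S.isClosed_filt i).preimage X.fam.continuous_proj

instance (X : StratBundle V S F) (i : ℕ) : T2Space (X.att i).Total := (X.isBundle_att i).t2Space

instance (X : StratBundle V S F) (i : ℕ) : SequentialSpace (X.att i).Total :=
  (X.isBundle_att i).sequentialSpace

/-- Needed for lifting sequences through the characteristic maps. In the first stratum containing
it, a point either lies in the Hausdorff bundle over `filt 0`, or has at most one preimage in the
attached bundle and does not meet the previous stage. -/
instance (X : StratBundle V S F) : T1Space X.fam.Total := by
  classical
  refine ⟨fun x => ?_⟩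
  have hex : ∃ n, x ∈ X.fam.proj ⁻¹' S.filt n := mem_iUnion.1 (X.isColimit.iUnion_eq ▸ mem_univ x)
  have hn := Nat.find_spec hex
  have hlt := fun i => Nat.find_min hex (m := i)
  generalize Nat.find hex = n at hn hlt
  suffices IsClosed ((↑) ⁻¹' {x} : Set (X.fam.proj ⁻¹' S.filt n)) by
    have := (X.isClosed_proj_filt n).isClosedEmbedding_subtypeVal.isClosedMap _ this
    rwa [Subtype.image_preimage_coe, inter_eq_self_of_subset_right (by simpa using hn)] at this
  cases n with
  | zero =>
    have : T2Space (X.fam.restrict (S.filt 0)).Total := X.isBundle_zero.restrict.t2Space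
    have : T2Space (X.fam.proj ⁻¹' S.filt 0) := this
    exact Subsingleton.isClosed fun y hy z hz => Subtype.ext (hy.trans hz.symm)
  | succ i =>
    have hx := hlt i (Nat.lt_succ_self i)
    have hA : ∀ y, (X.char i).toFun y = x → y ∉ (X.att i).proj ⁻¹' S.A i := fun y hy hyA =>
      hx (hy ▸ (X.isAttached i).mapsTo hyA)
    refine ((X.isAttached i).isClosed_iff {x} (by simpa using hn)).2 ⟨?_, ?_⟩
    · exact Subsingleton.isClosed fun y hy z hz =>
        (X.isAttached i).bijOn.injOn (hA y hy) (hA z hz) (hy.trans hz.symm)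
    · convert isClosed_empty
      refine eq_empty_of_forall_notMem fun y hy => hx ?_
      have : y.1 = x := hy
      exact this ▸ y.2

theorem liftsSequences (X : StratBundle V S F) (i : ℕ) :
    LiftsSequences ((X.att i).proj ⁻¹' S.A i) (X.char i).toFun :=
  (X.isAttached i).liftsSequences (X.isClosed_proj_filt (i + 1))

theorem liftsSequences_zero (X : StratBundle V S F) (A : Set (S.filt 0)) :
    LiftsSequences ((X.fam.restrict (S.filt 0)).proj ⁻¹' A)
      (X.fam.restrictIncl (S.filt 0)).toFun :=
  isClosedEmbedding_liftsSequences (X.isClosed_proj_filt 0).isClosedEmbedding_subtypeVal _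

end StratBundle

end Strat

/-! ### Continuity of induced maps of bundles -/

section BiMap

variable {V V' W : StructureCategory.{u}} {ψ : V.Ob × V'.Ob ⥤ W.Ob}
  {B B' B'' : Type u} [TopologicalSpace B] [TopologicalSpace B'] [TopologicalSpace B'']
  {F : B → V.Ob} {F' : B → V'.Ob} {G : B' → V.Ob} {G' : B' → V'.Ob} {H : B'' → V.Ob}
  {H' : B'' → V'.Ob} {X : VFamily V B F} {X' : VFamily V' B F'} {Y : VFamily V B' G}
  {Y' : VFamily V' B' G'} {Z : VFamily V B'' H} {Z' : VFamily V' B'' H'}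

theorem biMap_comp {φ : C(B, B')} {χ : C(B', B'')} (f : VMap φ X Y) (f' : VMap φ X' Y')
    (g : VMap χ Y Z) (g' : VMap χ Y' Z') (x : BiTotal ψ X X') :
    biMap ψ g g' (biMap ψ f f' x) = biMap ψ (g.comp f) (g'.comp f') x := by
  refine congrArg (BiTotal.mk (χ (φ x.base))) ?_
  change _ = toLin (bimap ψ (f.fiberMap x.base ≫ g.fiberMap (φ x.base))
    (f'.fiberMap x.base ≫ g'.fiberMap (φ x.base))) x.vec
  rw [bimap_comp]
  rfl

theorem biMap_congr {φ χ : C(B, B')} {f : VMap φ X Y} {f' : VMap φ X' Y'} {g : VMap χ X Y}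
    {g' : VMap χ X' Y'} (h : ∀ x, f.toFun x = g.toFun x) (h' : ∀ x, f'.toFun x = g'.toFun x)
    (x : BiTotal ψ X X') : biMap ψ f f' x = biMap ψ g g' x :=
  BiTotal.mk_eq_mk_of_emb (fun v => by rw [← f.map_emb, ← g.map_emb, h])
    (fun v => by rw [← f'.map_emb, ← g'.map_emb, h']) x.vec

theorem biMap_restrictIncl {C : Set B} (x : BiTotal ψ (X.restrict C) (X'.restrict C)) :
    biMap ψ (X.restrictIncl C) (X'.restrictIncl C) x = ⟨x.base, x.vec⟩ := by
  refine congrArg (BiTotal.mk x.base.1) ?_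
  change toLin (bimap ψ (𝟙 _) (𝟙 _)) x.vec = _
  rw [bimap_id]
  rfl

theorem BiTotal.continuous_of_biTriv {T : Type*} [TopologicalSpace T] {f : BiTotal ψ X X' → T}
    (h : ∀ (N : Set B) (V₀ : V.Ob) (V₀' : V'.Ob) (e : ∀ b : N, V₀ ≅ F b)
      (e' : ∀ b : N, V₀' ≅ F' b), IsOpen N → X.Triv (Subtype.val : N → B) V₀ e →
      X'.Triv (Subtype.val : N → B) V₀' e' → Continuous (f ∘ biTriv ψ X X' Subtype.val e e')) :
    Continuous f :=
  ⟨fun _ hO N V₀ V₀' e e' hN he he' => hO.preimage (h N V₀ V₀' e e' hN he he')⟩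

/-- Here the target consists of bundles, so the continuity of ψ suffices and no closure is involved.
-/
theorem continuous_biMap (hψ : IsContinuousBifunctor ψ) (hY : Y.IsBundleOn univ) (hY' : Y'.IsBundleOn univ) {φ : C(B, B')}
    (f : VMap φ X Y) (f' : VMap φ X' Y') : Continuous (biMap ψ f f') := by
  refine BiTotal.continuous_of_biTriv fun N V₀ V₀' e e' hN he he' => ?_
  have hb : Continuous fun q : N × ψ.obj (V₀, V₀') => φ q.1 := by fun_prop
  refine (BiTotal.continuous_mk hψ hY hY' hb
    (k := fun q => (e q.1).hom ≫ f.fiberMap q.1) (k' := fun q => (e' q.1).hom ≫ f'.fiberMap q.1)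
    (fun v => ?_) (fun v => ?_) continuous_snd).congr fun q => ?_
  · refine (f.toFun.continuous.comp (he.continuous.comp
      (continuous_fst.prodMk (continuous_const (y := v))))).congr fun q => f.map_emb _ _
  · refine (f'.toFun.continuous.comp (he'.continuous.comp
      (continuous_fst.prodMk (continuous_const (y := v))))).congr fun q => f'.map_emb _ _
  · rw [bimap_comp]
    rfl

theorem BiTotal.sequentialSpace [SequentialSpace B] (hψ : IsContinuousBifunctor ψ)
    (hX : X.IsBundleOn univ) (hX' : X'.IsBundleOn univ) : SequentialSpace (BiTotal ψ X X') :=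
  ((biBundle_isInducedOn hψ hX hX').isBundleOn hX hX').sequentialSpace

theorem BiTotal.isClosedEmbedding_mk [T1Space B] (hψ : IsContinuousBifunctor ψ)
    (hX : X.IsBundleOn univ) (hX' : X'.IsBundleOn univ) (b : B) :
    IsClosedEmbedding (BiTotal.mk b : ψ.obj (F b, F' b) → BiTotal ψ X X') := by
  refine ⟨BiTotal.isEmbedding_mk hψ hX hX' b, ?_⟩
  convert (isClosed_singleton (x := b)).preimage (BiTotal.continuous_base (X := X) (X' := X')) using 1
  ext ⟨b', v⟩
  constructor
  · rintro ⟨w, hw⟩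
    exact congrArg BiTotal.base hw.symm
  · rintro rfl
    exact ⟨v, rfl⟩

end BiMap

end StratBdl

namespace StratBdl

open Filter Set

/-! ### The stratified bundle induced by a regular continuous bifunctor -/

theorem isEmbedding_congr {X Y : Type*} [TopologicalSpace X] [TopologicalSpace Y] {f g : X → Y}
    (hf : IsEmbedding f) (h : ∀ x, f x = g x) : IsEmbedding g :=
  funext h ▸ hf

section Induced

variable {V V' W : StructureCategory.{u}} (ψ : V.Ob × V'.Ob ⥤ W.Ob) (P : VStraPair V V')

/-- The total space of the stratified bundle with fibers `ψ(X_b, X'_b)`, with the topology of the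
space obtained from `ψ(X₀, X'₀)` by successively attaching the bundles `ψ(Mᵢ, M'ᵢ)`. -/
def StratTotal : Type u := BiTotal ψ P.fst.fam P.snd.fam

/-- The part of the induced stratified bundle over the bottom stratum, as a bundle. -/
abbrev ZeroTotal : Type u :=
  BiTotal ψ (P.fst.fam.restrict (P.base.filt 0)) (P.snd.fam.restrict (P.base.filt 0))

/-- The attached bundles of the induced stratified bundle. -/
abbrev AttTotal (i : ℕ) : Type u := BiTotal ψ (P.fst.att i) (P.snd.att i)

namespace StratTotal

def mk (b : P.base) (v : ψ.obj (P.fibers₁.base b, P.fibers₂.base b)) : StratTotal ψ P :=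
  BiTotal.mk b v

def base (x : StratTotal ψ P) : P.base := BiTotal.base x

def zero (x : ZeroTotal ψ P) : StratTotal ψ P :=
  biMap ψ (P.fst.fam.restrictIncl (P.base.filt 0)) (P.snd.fam.restrictIncl (P.base.filt 0)) x

def char (i : ℕ) (x : AttTotal ψ P i) : StratTotal ψ P :=
  biMap ψ (P.fst.char i) (P.snd.char i) x

/-- The topology of `BiTotal` is unsuitable here, since a stratified bundle may lack trivializations
over open sets. All pieces are glued at once instead of inductively; that this agrees with
successive attaching is the content of `isClosed_of_char`. -/
instance : TopologicalSpace (StratTotal ψ P) :=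
  .coinduced (zero ψ P) inferInstance ⊔ ⨆ i, .coinduced (char ψ P i) inferInstance

variable {ψ P}

theorem isClosed_iff {S : Set (StratTotal ψ P)} :
    IsClosed S ↔ IsClosed (zero ψ P ⁻¹' S) ∧ ∀ i, IsClosed (char ψ P i ⁻¹' S) := by
  simp only [← isOpen_compl_iff, ← preimage_compl]
  exact and_congr Iff.rfl (isOpen_iSup_iff.trans (forall_congr' fun i => isOpen_coinduced))

theorem continuous_dom {T : Type*} [TopologicalSpace T] {f : StratTotal ψ P → T}
    (h : Continuous (f ∘ zero ψ P)) (h' : ∀ i, Continuous (f ∘ char ψ P i)) : Continuous f :=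
  continuous_iff_isClosed.2 fun _ hS =>
    isClosed_iff.2 ⟨hS.preimage h, fun i => hS.preimage (h' i)⟩

theorem continuous_zero : Continuous (zero ψ P) :=
  continuous_iff_isClosed.2 fun _ hS => (isClosed_iff.1 hS).1

theorem continuous_char (i : ℕ) : Continuous (char ψ P i) :=
  continuous_iff_isClosed.2 fun _ hS => (isClosed_iff.1 hS).2 i

theorem zero_apply (x : ZeroTotal ψ P) : zero ψ P x = mk ψ P x.base x.vec :=
  biMap_restrictIncl x

theorem continuous_base : Continuous (base ψ P) :=
  continuous_dom (continuous_subtype_val.comp BiTotal.continuous_base)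
    fun i => (P.base.char i).continuous.comp BiTotal.continuous_base

theorem zero_injective : Function.Injective (zero ψ P) := by
  rintro ⟨b, v⟩ ⟨b', v'⟩ h
  rw [zero_apply, zero_apply] at h
  obtain rfl : b = b' := Subtype.ext (congrArg (base ψ P) h)
  exact congrArg (BiTotal.mk b) (eq_of_heq (BiTotal.mk.inj h).2)

theorem isIso_char (i : ℕ) {m : P.base.M i} (hm : m ∉ P.base.A i) :
    IsIso (bimap ψ ((P.fst.char i).fiberMap m) ((P.snd.char i).fiberMap m)) :=
  have := P.fst.isIso_char i m hm
  have := P.snd.isIso_char i m hm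
  isIso_bimap _ _

theorem bijOn_char (i : ℕ) : BijOn (char ψ P i) (BiTotal.base ⁻¹' P.base.A i)ᶜ
    (base ψ P ⁻¹' P.base.filt (i + 1) \ base ψ P ⁻¹' P.base.filt i) := by
  have hbij := (P.base.isAttached i).bijOn
  refine ⟨fun x hx => hbij.mapsTo hx, ?_, ?_⟩
  · rintro ⟨m, v⟩ hm ⟨m', v'⟩ hm' h
    obtain rfl : m = m' := hbij.injOn hm hm' (congrArg (base ψ P) h)
    have := isIso_char (ψ := ψ) i hm
    exact congrArg (BiTotal.mk m) (toLin_injective_of_isIso _ (eq_of_heq (BiTotal.mk.inj h).2))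
  · rintro ⟨b, v⟩ hb
    obtain ⟨m, hm, rfl⟩ := hbij.surjOn hb
    have := isIso_char (ψ := ψ) i hm
    exact ⟨⟨m, toLin (inv (bimap ψ ((P.fst.char i).fiberMap m) ((P.snd.char i).fiberMap m))) v⟩, hm,
      congrArg (BiTotal.mk (P.base.char i m)) (toLin_hom_inv (asIso
        (bimap ψ ((P.fst.char i).fiberMap m) ((P.snd.char i).fiberMap m))) v)⟩

variable (hψ : IsRegularContinuous ψ)
include hψ

/-- Preimages in the attached bundles are tested on sequences. Those coming from the bottom stratum
lift to it, with empty exceptional set because the fiber maps of the inclusion are identities. -/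
theorem isClosedEmbedding_zero : IsClosedEmbedding (zero ψ P) := by
  obtain ⟨Ψ⟩ := hψ.exists_closureExtension
  refine .of_continuous_injective_isClosedMap continuous_zero zero_injective fun K hK => ?_
  refine isClosed_iff.2 ⟨by rwa [preimage_image_eq _ zero_injective], fun j => ?_⟩
  have := BiTotal.sequentialSpace hψ.1 (P.fst.isBundle_att j) (P.snd.isBundle_att j)
  refine IsSeqClosed.isClosed fun x x₀ hx hx₀ => ?_
  choose z hz hzx using hx
  obtain ⟨r, y, hy, hyx⟩ := exists_subseq_tendsto_of_biMap_eq hψ.1 Ψ (P.fst.char j) (P.snd.char j)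
    (P.fst.fam.restrictIncl (P.base.filt 0)) (P.snd.fam.restrictIncl (P.base.filt 0))
    (P.fst.isBundle_att j) (P.snd.isBundle_att j) P.fst.isBundle_zero.restrict
    P.snd.isBundle_zero.restrict (P.fst.liftsSequences_zero ∅) (P.snd.liftsSequences_zero ∅)
    (fun m _ => inferInstanceAs (IsIso (𝟙 _))) (fun m _ => inferInstanceAs (IsIso (𝟙 _))) hx₀
    (fun n => notMem_empty (z n).base) (fun n => (hzx n).symm)
  exact ⟨y, hK.mem_of_tendsto hy (Eventually.of_forall fun n => hz (r n)), hyx⟩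

/-- The topology demands a closed preimage in every attached bundle `j`, while the hypotheses
concern only `i`. A convergent sequence in bundle `j` that maps into `S` either meets the part over
`filt i` infinitely often, where `h0` applies, or eventually lifts to the new part of bundle `i`;
there a subsequence of the lifts converges and `hc` applies. -/
theorem isClosed_of_char {i : ℕ} {S : Set (StratTotal ψ P)}
    (hS : S ⊆ base ψ P ⁻¹' P.base.filt (i + 1)) (hc : IsClosed (char ψ P i ⁻¹' S))
    (h0 : IsClosed (S ∩ base ψ P ⁻¹' P.base.filt i)) : IsClosed S := by
  obtain ⟨Ψ⟩ := hψ.exists_closureExtension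
  refine isClosed_iff.2 ⟨?_, fun j => ?_⟩
  · convert h0.preimage continuous_zero using 1
    ext x
    exact ⟨fun h => ⟨h, P.base.filt_mono (Nat.zero_le i) x.base.2⟩, fun h => h.1⟩
  · have := BiTotal.sequentialSpace hψ.1 (P.fst.isBundle_att j) (P.snd.isBundle_att j)
    refine IsSeqClosed.isClosed fun x x₀ hx hx₀ => ?_
    by_cases hf : ∃ᶠ n in atTop, char ψ P j (x n) ∈ base ψ P ⁻¹' P.base.filt i
    · have : IsClosed (char ψ P j ⁻¹' (S ∩ base ψ P ⁻¹' P.base.filt i)) :=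
        h0.preimage (continuous_char j)
      exact (this.mem_of_frequently_of_tendsto (hf.mono fun n hn => ⟨hx n, hn⟩) hx₀).1
    · obtain ⟨L, hL⟩ := eventually_atTop.1 (not_frequently.1 hf)
      have hex : ∀ n, ∃ z ∈ (BiTotal.base ⁻¹' P.base.A i)ᶜ,
          char ψ P i z = char ψ P j (x (n + L)) := fun n =>
        (bijOn_char i).surjOn ⟨hS (hx _), hL _ (Nat.le_add_left _ _)⟩
      choose z hzA hzx using hex
      obtain ⟨r, y, hy, hyx⟩ := exists_subseq_tendsto_of_biMap_eq hψ.1 Ψ (P.fst.char j)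
        (P.snd.char j) (P.fst.char i) (P.snd.char i) (P.fst.isBundle_att j) (P.snd.isBundle_att j)
        (P.fst.isBundle_att i) (P.snd.isBundle_att i) (P.fst.liftsSequences i)
        (P.snd.liftsSequences i) (P.fst.isIso_char i) (P.snd.isIso_char i)
        ((tendsto_add_atTop_iff_nat L).2 hx₀) hzA (fun n => (hzx n).symm)
      have hyS : char ψ P i y ∈ S := hc.mem_of_tendsto hy (Eventually.of_forall fun n => by
        rw [mem_preimage, hzx]
        exact hx _)
      have hyx' : char ψ P i y = char ψ P j x₀ := hyx
      rwa [mem_preimage, ← hyx']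

/-- A closed subset of a fiber over a new point has only itself as preimage in its attached bundle
and is disjoint from the previous stage, so `isClosed_of_char` applies. -/
theorem isClosedEmbedding_char_mk (i : ℕ) {m : P.base.M i} (hm : m ∉ P.base.A i) :
    IsClosedEmbedding fun v => char ψ P i ⟨m, v⟩ := by
  have hmk := BiTotal.isClosedEmbedding_mk hψ.1 (P.fst.isBundle_att i) (P.snd.isBundle_att i) m
  refine .of_continuous_injective_isClosedMap ((continuous_char i).comp hmk.continuous)
    (fun v w h => hmk.injective ((bijOn_char i).injOn hm hm h)) fun K hK => ?_
  have hpre : ∀ x (v : ψ.obj (P.fibers₁.att i m, P.fibers₂.att i m)),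
      char ψ P i x = char ψ P i ⟨m, v⟩ → x = ⟨m, v⟩ := fun x v h => by
    refine (bijOn_char i).injOn (fun hx => hm ?_) hm h
    refine (P.base.char_mem_iff i m).1 ?_
    have hb : P.base.char i x.base = P.base.char i m := congrArg (base ψ P) h
    exact hb ▸ (P.base.char_mem_iff i x.base).2 hx
  refine isClosed_of_char hψ (i := i) ?_ ?_ ?_
  · rintro _ ⟨v, -, rfl⟩
    exact P.base.char_mem i m
  · convert hmk.isClosedMap K hK using 1
    ext x
    constructor
    · rintro ⟨v, hv, hvx⟩
      exact ⟨v, hv, (hpre x v hvx.symm).symm⟩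
    · rintro ⟨v, hv, rfl⟩
      exact ⟨v, hv, rfl⟩
  · convert isClosed_empty
    refine eq_empty_of_forall_notMem ?_
    rintro _ ⟨⟨v, -, rfl⟩, h⟩
    exact hm ((P.base.char_mem_iff i m).1 h)

/-- The topology of a fiber is read off in the first stratum containing `b`: over `filt 0` from the
bundle there, otherwise from the unique new point of the attached space over `b`. -/
theorem isEmbedding_mk (b : P.base) : IsEmbedding (mk ψ P b) := by
  classical
  have hex : ∃ n, b ∈ P.base.filt n := mem_iUnion.1 (P.base.isColimit.iUnion_eq ▸ mem_univ b)
  have hn := Nat.find_spec hex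
  have hlt := fun i => Nat.find_min hex (m := i)
  generalize Nat.find hex = n at hn hlt
  cases n with
  | zero =>
    exact isEmbedding_congr ((isClosedEmbedding_zero hψ).isEmbedding.comp (BiTotal.isEmbedding_mk
      hψ.1 P.fst.isBundle_zero.restrict P.snd.isBundle_zero.restrict ⟨b, hn⟩))
      fun v => zero_apply _
  | succ i =>
    obtain ⟨m, hm, rfl⟩ := (P.base.isAttached i).bijOn.surjOn ⟨hn, hlt i (Nat.lt_succ_self i)⟩
    have := isIso_char (ψ := ψ) i hm
    let e := asIso (bimap ψ ((P.fst.char i).fiberMap m) ((P.snd.char i).fiberMap m))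
    exact isEmbedding_congr ((isClosedEmbedding_char_mk hψ i hm).isEmbedding.comp
      (homeomorphOfIso e).symm.isEmbedding) fun v =>
        congrArg (BiTotal.mk (P.base.char i m)) (toLin_hom_inv e v)

end StratTotal

variable {ψ}

/-- The family with fibers `ψ(X_b, X'_b)`. -/
noncomputable def inducedFamily (hψ : IsRegularContinuous ψ) :
    VFamily W P.base (P.fibers ψ).base :=
  VFamily.ofFibers (StratTotal ψ P) (StratTotal.base ψ P) StratTotal.continuous_base
    (StratTotal.mk ψ P) (StratTotal.isEmbedding_mk hψ) fun b => by
      ext ⟨b', v⟩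
      constructor
      · rintro ⟨w, hw⟩
        exact congrArg (StratTotal.base ψ P) hw.symm
      · rintro rfl
        exact ⟨v, rfl⟩

theorem inducedFamily_isInducedOn (hψ : IsRegularContinuous ψ) :
    IsInducedOn ψ P.fst.fam P.snd.fam (inducedFamily P hψ) (P.base.filt 0) := by
  intro U V₀ V₀' e e' hU he he'
  have hs : IsEmbedding (inclusion hU) := .inclusion hU
  have h := biBundle_triv hψ.1 P.fst.isBundle_zero.restrict P.snd.isBundle_zero.restrict hs
    (VFamily.triv_restrict_iff.2 he) (VFamily.triv_restrict_iff.2 he')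
  exact isEmbedding_congr ((StratTotal.isClosedEmbedding_zero hψ).isEmbedding.comp h)
    fun q => StratTotal.zero_apply _

/-- The characteristic maps of the induced stratified bundle. -/
noncomputable def inducedChar (hψ : IsRegularContinuous ψ) (i : ℕ) :
    VMap (P.base.char i) (biBundle hψ.1 (P.fst.isBundle_att i) (P.snd.isBundle_att i))
      (inducedFamily P hψ) where
  toFun := ⟨StratTotal.char ψ P i, StratTotal.continuous_char i⟩
  fiberMap m := bimap ψ ((P.fst.char i).fiberMap m) ((P.snd.char i).fiberMap m)
  map_emb _ _ := rfl

theorem inducedChar_isAttached (hψ : IsRegularContinuous ψ) (i : ℕ) :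
    IsAttached ((inducedFamily P hψ).proj ⁻¹' P.base.filt i)
      ((inducedFamily P hψ).proj ⁻¹' P.base.filt (i + 1))
      ((biBundle hψ.1 (P.fst.isBundle_att i) (P.snd.isBundle_att i)).proj ⁻¹' P.base.A i)
      (inducedChar P hψ i).toFun where
  continuous := (inducedChar P hψ i).toFun.continuous
  subset := preimage_mono (P.base.isAttached i).subset
  mapsTo _ hx := (P.base.isAttached i).mapsTo hx
  bijOn := StratTotal.bijOn_char i
  isClosed_iff S hS := by
    have hcl : ∀ n, IsClosed ((inducedFamily P hψ).proj ⁻¹' P.base.filt n) := fun n =>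
      (P.base.isClosed_filt n).preimage (inducedFamily P hψ).continuous_proj
    constructor
    · intro h
      have h' := (hcl (i + 1)).isClosedEmbedding_subtypeVal.isClosedMap _ h
      rw [Subtype.image_preimage_coe, inter_eq_self_of_subset_right hS] at h'
      exact ⟨h'.preimage (inducedChar P hψ i).toFun.continuous, h'.preimage continuous_subtype_val⟩
    -- The substantial direction; the other one is continuity.
    · rintro ⟨h1, h2⟩
      have h' := (hcl i).isClosedEmbedding_subtypeVal.isClosedMap _ h2
      rw [Subtype.image_preimage_coe, inter_comm] at h'
      exact (StratTotal.isClosed_of_char hψ hS h1 h').preimage continuous_subtype_val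

theorem inducedFamily_isColimit (hψ : IsRegularContinuous ψ) :
    IsFiltrationColimit fun n => (inducedFamily P hψ).proj ⁻¹' P.base.filt n where
  iUnion_eq := by rw [← preimage_iUnion, P.base.isColimit.iUnion_eq, preimage_univ]
  isClosed_of S hS := by
    refine StratTotal.isClosed_iff.2 ⟨?_, fun i => ?_⟩
    · exact (hS 0).preimage (continuous_induced_rng.2 StratTotal.continuous_zero :
        Continuous fun x => (⟨StratTotal.zero ψ P x, x.base.2⟩ :
          (inducedFamily P hψ).proj ⁻¹' P.base.filt 0))
    · exact (hS (i + 1)).preimage (continuous_induced_rng.2 (StratTotal.continuous_char i) :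
        Continuous fun x => (⟨StratTotal.char ψ P i x, P.base.char_mem i x.base⟩ :
          (inducedFamily P hψ).proj ⁻¹' P.base.filt (i + 1)))

/-- The stratified bundle with fibers `ψ(X_b, X'_b)`. -/
noncomputable def inducedBundle (hψ : IsRegularContinuous ψ) :
    StratBundle W P.base (P.fibers ψ) where
  fam := inducedFamily P hψ
  att i := biBundle hψ.1 (P.fst.isBundle_att i) (P.snd.isBundle_att i)
  char := inducedChar P hψ
  isBundle_zero := (inducedFamily_isInducedOn P hψ).isBundleOn P.fst.isBundle_zero
    P.snd.isBundle_zero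
  isBundle_att i := (biBundle_isInducedOn hψ.1 (P.fst.isBundle_att i)
    (P.snd.isBundle_att i)).isBundleOn (P.fst.isBundle_att i) (P.snd.isBundle_att i)
  isAttached := inducedChar_isAttached P hψ
  isIso_char i _ hm := StratTotal.isIso_char i hm
  isColimit := inducedFamily_isColimit P hψ

theorem inducedBundle_isInduced (hψ : IsRegularContinuous ψ) :
    IsInduced ψ P (inducedBundle P hψ) where
  zero := inducedFamily_isInducedOn P hψ
  att i := biBundle_isInducedOn hψ.1 (P.fst.isBundle_att i) (P.snd.isBundle_att i)
  char _ _ := rfl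

variable {P}

variable (ψ) in
/-- The map of total spaces induced by a morphism of pairs of stratified bundles. -/
def StratTotal.map {Q : VStraPair V V'} (f : P ⟶ Q) (x : StratTotal ψ P) : StratTotal ψ Q :=
  biMap ψ f.fst.map f.snd.map x

/-- By the final topology it suffices to look at the bottom piece and the attached pieces. On each
the map factors through a map of bundles, which is continuous, followed by the structure map of the
target. -/
theorem StratTotal.continuous_map (hψ : IsRegularContinuous ψ) {Q : VStraPair V V'} (f : P ⟶ Q) :
    Continuous (StratTotal.map ψ f) := by
  refine StratTotal.continuous_dom ?_ fun i => ?_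
  · refine (StratTotal.continuous_zero.comp (continuous_biMap hψ.1
      Q.fst.isBundle_zero.restrict Q.snd.isBundle_zero.restrict
      (f.fst.map.restrict (f.base.mapsTo_filt 0))
      (f.snd.map.restrict (f.base.mapsTo_filt 0)))).congr fun x => ?_
    refine (biMap_comp _ _ _ _ x).trans (Eq.trans ?_ (biMap_comp _ _ _ _ x).symm)
    exact biMap_congr (fun _ => rfl) (fun _ => rfl) x
  · refine ((StratTotal.continuous_char i).comp (continuous_biMap hψ.1 (Q.fst.isBundle_att i)
      (Q.snd.isBundle_att i) (f.fst.att i) (f.snd.att i))).congr fun x => ?_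
    refine (biMap_comp _ _ _ _ x).trans (Eq.trans ?_ (biMap_comp _ _ _ _ x).symm)
    exact biMap_congr (fun y => (f.fst.comm i y).symm) (fun y => (f.snd.comm i y).symm) x

/-- The stratified map which is given on fibers by `ψ(f_b, f'_b)`. -/
noncomputable def inducedMap (hψ : IsRegularContinuous ψ) {Q : VStraPair V V'} (f : P ⟶ Q) :
    StratBundleMap f.base (inducedBundle P hψ) (inducedBundle Q hψ) where
  map :=
    { toFun := ⟨StratTotal.map ψ f, StratTotal.continuous_map hψ f⟩
      fiberMap b := bimap ψ (f.fst.map.fiberMap b) (f.snd.map.fiberMap b)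
      map_emb _ _ := rfl }
  att i :=
    { toFun := ⟨biMap ψ (f.fst.att i) (f.snd.att i), continuous_biMap hψ.1 (Q.fst.isBundle_att i)
        (Q.snd.isBundle_att i) _ _⟩
      fiberMap m := bimap ψ ((f.fst.att i).fiberMap m) ((f.snd.att i).fiberMap m)
      map_emb _ _ := rfl }
  comm i x := (biMap_comp _ _ _ _ x).trans (Eq.trans
    (biMap_congr (f.fst.comm i) (f.snd.comm i) x) (biMap_comp _ _ _ _ x).symm)

theorem inducedMap_isInducedMap (hψ : IsRegularContinuous ψ) {Q : VStraPair V V'} (f : P ⟶ Q) :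
    IsInducedMap ψ f (inducedMap hψ f) where
  map _ := rfl
  att _ _ := rfl

/-- Reduces functoriality to the functoriality of ψ on fibers. -/
theorem StratBundleMap.ext {S T : StratSpace.{u}} {φ : StratMap S T} {F : Fibers V S}
    {G : Fibers V T} {X : StratBundle V S F} {Y : StratBundle V T G} {f g : StratBundleMap φ X Y}
    (h : ∀ b, f.map.fiberMap b = g.map.fiberMap b)
    (h' : ∀ i m, (f.att i).fiberMap m = (g.att i).fiberMap m) : f = g := by
  obtain ⟨f₁, f₂, hf⟩ := f
  obtain ⟨g₁, g₂, hg⟩ := g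
  obtain rfl : f₁ = g₁ := VMap.ext h
  obtain rfl : f₂ = g₂ := funext fun i => VMap.ext (h' i)
  rfl

theorem inducedMap_id (hψ : IsRegularContinuous ψ) (P : VStraPair V V') :
    inducedMap hψ (𝟙 P) = StratBundleMap.id (inducedBundle P hψ) :=
  StratBundleMap.ext (fun b => bimap_id ψ (P.fibers₁.base b) (P.fibers₂.base b))
    fun i m => bimap_id ψ (P.fibers₁.att i m) (P.fibers₂.att i m)

theorem inducedMap_comp (hψ : IsRegularContinuous ψ) {Q R : VStraPair V V'} (f : P ⟶ Q)
    (g : Q ⟶ R) : inducedMap hψ (f ≫ g) = (inducedMap hψ g).comp (inducedMap hψ f) :=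
  StratBundleMap.ext
    (fun b => bimap_comp ψ (f.fst.map.fiberMap b) (f.snd.map.fiberMap b)
      (g.fst.map.fiberMap _) (g.snd.map.fiberMap _))
    fun i m => bimap_comp ψ ((f.fst.att i).fiberMap m) ((f.snd.att i).fiberMap m)
      ((g.fst.att i).fiberMap _) ((g.snd.att i).fiberMap _)

/-- The functor induced by a regular continuous bifunctor. -/
noncomputable def inducedFunctor (hψ : IsRegularContinuous ψ) : VStraPair V V' ⥤ VStra W where
  obj P := ⟨P.base, P.fibers ψ, inducedBundle P hψ⟩
  map f := ⟨f.base, inducedMap hψ f⟩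
  map_id P :=
    congrArg (VStra.Hom.mk (X := ⟨P.base, P.fibers ψ, inducedBundle P hψ⟩)
      (Y := ⟨P.base, P.fibers ψ, inducedBundle P hψ⟩) (StratMap.id P.base)) (inducedMap_id hψ P)
  map_comp {P _ R} f g :=
    congrArg (VStra.Hom.mk (X := ⟨P.base, P.fibers ψ, inducedBundle P hψ⟩)
      (Y := ⟨R.base, R.fibers ψ, inducedBundle R hψ⟩) (f ≫ g).base) (inducedMap_comp hψ f g)

end Induced

end StratBdl

namespace StratBdl

/-! ### Direct sums and tensor products -/

section Bilinear

variable {V V' W : StructureCategory.{u}}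

/-- The direct sum of two morphisms is jointly linear in the pair, and linear maps are continuous
for module topologies. -/
theorem continuous_prodMap_lin (X Y X' Y' : FGModuleCat.{u} ℝ) :
    letI := linTop X Y
    letI := linTop X' Y'
    letI := linTop (FGModuleCat.of ℝ (X × X')) (FGModuleCat.of ℝ (Y × Y'))
    Continuous fun q : (X →ₗ[ℝ] Y) × (X' →ₗ[ℝ] Y') =>
      (q.1.prodMap q.2 : FGModuleCat.of ℝ (X × X') →ₗ[ℝ] FGModuleCat.of ℝ (Y × Y')) := by
  let _ := linTop X Y
  let _ := linTop X' Y'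
  let _ := linTop (FGModuleCat.of ℝ (X × X')) (FGModuleCat.of ℝ (Y × Y'))
  have : IsModuleTopology ℝ (X →ₗ[ℝ] Y) := ⟨rfl⟩
  have : IsModuleTopology ℝ (X' →ₗ[ℝ] Y') := ⟨rfl⟩
  have : IsModuleTopology ℝ
    (FGModuleCat.of ℝ (X × X') →ₗ[ℝ] FGModuleCat.of ℝ (Y × Y')) := ⟨rfl⟩
  have := IsModuleTopology.toContinuousAdd ℝ
    (FGModuleCat.of ℝ (X × X') →ₗ[ℝ] FGModuleCat.of ℝ (Y × Y'))
  exact IsModuleTopology.continuous_of_linearMap (LinearMap.prodMapLinear ℝ X X' Y Y' ℝ)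

/-- Here the dependence on the two morphisms is bilinear, and finite dimension gives joint
continuity. -/
theorem continuous_tensorMap_lin (X Y X' Y' : FGModuleCat.{u} ℝ) :
    letI := linTop X Y
    letI := linTop X' Y'
    letI := linTop (FGModuleCat.of ℝ (TensorProduct ℝ X X'))
      (FGModuleCat.of ℝ (TensorProduct ℝ Y Y'))
    Continuous fun q : (X →ₗ[ℝ] Y) × (X' →ₗ[ℝ] Y') =>
      (TensorProduct.map q.1 q.2 : FGModuleCat.of ℝ (TensorProduct ℝ X X') →ₗ[ℝ]
        FGModuleCat.of ℝ (TensorProduct ℝ Y Y')) := by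
  let _ := linTop X Y
  let _ := linTop X' Y'
  let _ := linTop (FGModuleCat.of ℝ (TensorProduct ℝ X X'))
      (FGModuleCat.of ℝ (TensorProduct ℝ Y Y'))
  have : IsModuleTopology ℝ (X →ₗ[ℝ] Y) := ⟨rfl⟩
  have : IsModuleTopology ℝ (X' →ₗ[ℝ] Y') := ⟨rfl⟩
  have : IsModuleTopology ℝ (FGModuleCat.of ℝ (TensorProduct ℝ X X') →ₗ[ℝ]
    FGModuleCat.of ℝ (TensorProduct ℝ Y Y')) := ⟨rfl⟩
  exact IsModuleTopology.continuous_bilinear_of_finite_left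
    (TensorProduct.mapBilinear (.id ℝ) X X' Y Y')

/-- Continuity of a bifunctor on morphism spaces follows from continuity of the underlying map of
spaces of linear maps. -/
theorem continuous_of_lin {X Y : V.Ob} {X' Y' : V'.Ob} {Z T : W.Ob}
    {m : (X ⟶ Y) × (X' ⟶ Y') → (Z ⟶ T)}
    {L : (X →ₗ[ℝ] Y) × (X' →ₗ[ℝ] Y') → (Z →ₗ[ℝ] T)}
    (hL : letI := linTop X.carrier Y.carrier
      letI := linTop X'.carrier Y'.carrier
      letI := linTop Z.carrier T.carrier
      Continuous L)
    (h : ∀ q, toLin (m q) = L (toLin q.1, toLin q.2)) : Continuous m := by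
  let _ := linTop X.carrier Y.carrier
  let _ := linTop X'.carrier Y'.carrier
  let _ := linTop Z.carrier T.carrier
  rw [(isInducing_toLin Z T).continuous_iff]
  exact (hL.comp ((isInducing_toLin X Y).continuous.prodMap
    (isInducing_toLin X' Y').continuous)).congr fun q => (h q).symm

/-- Ensures that the closure of `W` contains the sums, resp. tensor products, of morphisms in the
closures of `V` and `V'`. -/
theorem mem_closure_hom {X Y X' Y' Z T : FGModuleCat.{u} ℝ} {s : Set (X →ₗ[ℝ] Y)}
    {s' : Set (X' →ₗ[ℝ] Y')} {t : Set (Z →ₗ[ℝ] T)}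
    {L : (X →ₗ[ℝ] Y) × (X' →ₗ[ℝ] Y') → (Z →ₗ[ℝ] T)}
    (hL : letI := linTop X Y
      letI := linTop X' Y'
      letI := linTop Z T
      Continuous L)
    (h : ∀ f ∈ s, ∀ f' ∈ s', L (f, f') ∈ t) {f : X →ₗ[ℝ] Y} {f' : X' →ₗ[ℝ] Y'}
    (hf : f ∈ @closure _ (linTop X Y) s) (hf' : f' ∈ @closure _ (linTop X' Y') s') :
    L (f, f') ∈ @closure _ (linTop Z T) t := by
  let _ := linTop X Y
  let _ := linTop X' Y'
  let _ := linTop Z T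
  refine map_mem_closure hL (s := s ×ˢ s') ?_ fun q hq => h q.1 hq.1 q.2 hq.2
  rw [closure_prod_eq]
  exact ⟨hf, hf'⟩

theorem isContinuousBifunctor_directSum
    (hobj : ∀ (X : V.Ob) (X' : V'.Ob), FGModuleCat.of ℝ (X × X') ∈ W.obj)
    (hhom : ∀ {X Y : V.Ob} {X' Y' : V'.Ob} (f : X ⟶ Y) (f' : X' ⟶ Y'),
      (toLin f).prodMap (toLin f') ∈
        W.hom (FGModuleCat.of ℝ (X × X')) (FGModuleCat.of ℝ (Y × Y'))) :
    IsContinuousBifunctor (directSum V V' W hobj hhom) := fun X Y X' Y' =>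
  continuous_of_lin (continuous_prodMap_lin X.carrier Y.carrier X'.carrier Y'.carrier) fun _ => rfl

theorem isContinuousBifunctor_tensorProduct
    (hobj : ∀ (X : V.Ob) (X' : V'.Ob), FGModuleCat.of ℝ (TensorProduct ℝ X X') ∈ W.obj)
    (hhom : ∀ {X Y : V.Ob} {X' Y' : V'.Ob} (f : X ⟶ Y) (f' : X' ⟶ Y'),
      TensorProduct.map (toLin f) (toLin f') ∈
        W.hom (FGModuleCat.of ℝ (TensorProduct ℝ X X'))
          (FGModuleCat.of ℝ (TensorProduct ℝ Y Y'))) :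
    IsContinuousBifunctor (tensorProduct V V' W hobj hhom) := fun X Y X' Y' =>
  continuous_of_lin (continuous_tensorMap_lin X.carrier Y.carrier X'.carrier Y'.carrier)
    fun _ => rfl

/-- The extension is the direct sum between the closures. It is continuous for the same reason, and
it restricts to the given bifunctor definitionally. -/
theorem isRegularContinuous_directSum
    (hobj : ∀ (X : V.Ob) (X' : V'.Ob), FGModuleCat.of ℝ (X × X') ∈ W.obj)
    (hhom : ∀ {X Y : V.Ob} {X' Y' : V'.Ob} (f : X ⟶ Y) (f' : X' ⟶ Y'),
      (toLin f).prodMap (toLin f') ∈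
        W.hom (FGModuleCat.of ℝ (X × X')) (FGModuleCat.of ℝ (Y × Y'))) :
    IsRegularContinuous (directSum V V' W hobj hhom) :=
  ⟨isContinuousBifunctor_directSum hobj hhom,
    directSum V.closure V'.closure W.closure (fun X X' => hobj ⟨X.1, X.2⟩ ⟨X'.1, X'.2⟩)
      (fun {X Y X' Y'} f f' => mem_closure_hom
        (Z := FGModuleCat.of ℝ (X × X')) (T := FGModuleCat.of ℝ (Y × Y'))
        (s := V.hom X.carrier Y.carrier) (s' := V'.hom X'.carrier Y'.carrier)
        (t := W.hom (FGModuleCat.of ℝ (X × X')) (FGModuleCat.of ℝ (Y × Y')))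
        (L := fun q => q.1.prodMap q.2)
        (continuous_prodMap_lin X.carrier Y.carrier X'.carrier Y'.carrier)
        (fun g hg g' hg' => hhom (X := ⟨X.1, X.2⟩) (Y := ⟨Y.1, Y.2⟩) (X' := ⟨X'.1, X'.2⟩)
          (Y' := ⟨Y'.1, Y'.2⟩) ⟨g, hg⟩ ⟨g', hg'⟩) f.2 f'.2),
    isContinuousBifunctor_directSum _ _, rfl⟩

theorem isRegularContinuous_tensorProduct
    (hobj : ∀ (X : V.Ob) (X' : V'.Ob), FGModuleCat.of ℝ (TensorProduct ℝ X X') ∈ W.obj)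
    (hhom : ∀ {X Y : V.Ob} {X' Y' : V'.Ob} (f : X ⟶ Y) (f' : X' ⟶ Y'),
      TensorProduct.map (toLin f) (toLin f') ∈
        W.hom (FGModuleCat.of ℝ (TensorProduct ℝ X X'))
          (FGModuleCat.of ℝ (TensorProduct ℝ Y Y'))) :
    IsRegularContinuous (tensorProduct V V' W hobj hhom) :=
  ⟨isContinuousBifunctor_tensorProduct hobj hhom,
    tensorProduct V.closure V'.closure W.closure (fun X X' => hobj ⟨X.1, X.2⟩ ⟨X'.1, X'.2⟩)
      (fun {X Y X' Y'} f f' => mem_closure_hom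
        (Z := FGModuleCat.of ℝ (TensorProduct ℝ X X')) (T := FGModuleCat.of ℝ (TensorProduct ℝ Y Y'))
        (s := V.hom X.carrier Y.carrier) (s' := V'.hom X'.carrier Y'.carrier)
        (t := W.hom (FGModuleCat.of ℝ (TensorProduct ℝ X X')) (FGModuleCat.of ℝ (TensorProduct ℝ Y Y')))
        (L := fun q => TensorProduct.map q.1 q.2)
        (continuous_tensorMap_lin X.carrier Y.carrier X'.carrier Y'.carrier)
        (fun g hg g' hg' => hhom (X := ⟨X.1, X.2⟩) (Y := ⟨Y.1, Y.2⟩) (X' := ⟨X'.1, X'.2⟩)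
          (Y' := ⟨Y'.1, Y'.2⟩) ⟨g, hg⟩ ⟨g', hg'⟩) f.2 f'.2),
    isContinuousBifunctor_tensorProduct _ _, rfl⟩

end Bilinear

end StratBdl

theorem mainTheorem5 :
    (∀ (V V' W : StructureCategory.{u}) (ψ : V.Ob × V'.Ob ⥤ W.Ob), IsRegularContinuous ψ →
      ∃ (E : ∀ P : VStraPair V V', StratBundle W P.base (P.fibers ψ))
        (F : VStraPair V V' ⥤ VStra W)
        (hF : ∀ P, F.obj P = ⟨P.base, P.fibers ψ, E P⟩),
        (∀ P, IsInduced ψ P (E P)) ∧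
        ∀ (P Q : VStraPair V V') (f : P ⟶ Q),
          ∃ m : StratBundleMap f.base (E P) (E Q), IsInducedMap ψ f m ∧
            F.map f = eqToHom (hF P) ≫ VStra.Hom.mk f.base m ≫ eqToHom (hF Q).symm) ∧
    (∀ (V V' W : StructureCategory.{u})
      (hobj : ∀ (X : V.Ob) (X' : V'.Ob), FGModuleCat.of ℝ (X × X') ∈ W.obj)
      (hhom : ∀ {X Y : V.Ob} {X' Y' : V'.Ob} (f : X ⟶ Y) (f' : X' ⟶ Y'),
        (toLin f).prodMap (toLin f') ∈
          W.hom (FGModuleCat.of ℝ (X × X')) (FGModuleCat.of ℝ (Y × Y'))),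
      IsRegularContinuous (directSum V V' W hobj hhom)) ∧
    (∀ (V V' W : StructureCategory.{u})
      (hobj : ∀ (X : V.Ob) (X' : V'.Ob), FGModuleCat.of ℝ (TensorProduct ℝ X X') ∈ W.obj)
      (hhom : ∀ {X Y : V.Ob} {X' Y' : V'.Ob} (f : X ⟶ Y) (f' : X' ⟶ Y'),
        TensorProduct.map (toLin f) (toLin f') ∈
          W.hom (FGModuleCat.of ℝ (TensorProduct ℝ X X'))
            (FGModuleCat.of ℝ (TensorProduct ℝ Y Y'))),
      IsRegularContinuous (tensorProduct V V' W hobj hhom)) := by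
  refine ⟨fun V V' W ψ hψ => ?_, fun V V' W hobj hhom => isRegularContinuous_directSum hobj hhom,
    fun V V' W hobj hhom => isRegularContinuous_tensorProduct hobj hhom⟩
  refine ⟨fun P => inducedBundle P hψ, inducedFunctor hψ, fun _ => rfl,
    fun P => inducedBundle_isInduced P hψ, fun P Q f =>
      ⟨inducedMap hψ f, inducedMap_isInducedMap hψ f, ?_⟩⟩
  -- The object equalities hold by `rfl`, so both `eqToHom` are identities.
  exact ((Category.id_comp _).trans (Category.comp_id _)).symm
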